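/- A conformal superalgebra over $\mathbb C$ is a $\mathbb Z/2$-graded complex vector space $R$ with parity-compatible bilinear products $a_{(n)}b$ ($n\in\mathbb N$), a parity-preserving linear map $\partial:R\to R$ and an even vector $L\in R$ such that, for all $a,b,c\in R$ (homogeneous where the parity $p$ occurs) and $m,n\in\mathbb N$: * $a_{(n)}b=0$ for all sufficiently large $n$ (depending on $a,b$); * $(\partial a)_{(n)}b=-n\,a_{(n-1)}b$; * $a_{(n)}b=(-1)^{p(a)p(b)}\sum_{j\ge 0}(-1)^{j+n+1}\frac{\partial^{j}}{j!}(b_{(n+j)}a)$; * $a_{(m)}(b_{(n)}c)=\sum_{j=0}^{m}\binom mj (a_{(j)}b)_{(n+m-j)}c+(-1)^{p(a)p(b)}b_{(n)}(a_{(m)}c)$; * $L_{(0)}L=\partial L$, $L_{(1)}L=2L$, $L_{(2)}L=0$, $L_{(0)}=\partial$ on $R$, and $L_{(1)}$ is diagonalizable. Put $R^k=\{x\in R: L_{(1)}x=kx\}$. An ideal is a $\mathbb C[\partial]$-submodule closed under left multiplication by all products; $R$ is simple if it has no ideals other than $\{0\}$ and $R$. $R$ is a physical conformal superalgebra if there is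 a finite-dimensional $\mathbb Z/2$-graded subspace $\mathcal F\subset R$ with $R=\mathbb C[\partial]\mathcal F$, every $k$ with $R^k\neq 0$ lies in $\frac12\mathbb N$, $R_{\rm even}=\bigoplus_{n\in\mathbb N}R^n$, $R_{\rm odd}=\bigoplus_{n\in\mathbb N}R^{n+1/2}$, $\mathcal F\subset R^2\oplus R^{3/2}\oplus R^1\oplus R^{1/2}$ and $\mathcal F\cap R^2=\mathbb C L$. Let $R$ be a physical conformal superalgebra. Let $\check R=\{x\in R: L_{(2)}x\in R^0\}$ and $\check R^k=\check R\cap R^k$. Every $x\in R$ has a unique decomposition $x=\sum_{j\ge0}\frac{\partial^j}{j!}x^j$ (finite sum) with $x^0\in\check R$ and $x^j\in\bigoplus_{k\ne0}\check R^k$ for $j>0$; for $a,b\in\check R$ let $a_{\langle n\rangle}b=(a_{(n)}b)^0\in\check R$. Set $V=\check R^{3/2}$ and $F=\check R^{1/2}$. Then there is a unique bilinear form $(\cdot,\cdot)$ on $V$ (the inner product) with $u_{\langle 0\rangle}v=(u,v)L$ for all $u,v\in V$. Moreover: 1. If $R$ is simple, then $(\cdot,\cdot)$ is nondegenerate on $V$.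 2. If $V\ne\{0\}$, then $R$ is simple if and only if $(\cdot,\cdot)$ is nondegenerate and $F^3=\{0\}$, where $$F^3=\{f\in F:\ v^1_{\langle0\rangle}(v^2_{\langle0\rangle}(v^3_{\langle0\rangle}f))=0\ \text{for all } v^1,v^2,v^3\in V\}.$$ -/

import Mathlib

/-- A conformal superalgebra over `ℂ` on the vector space `R`: a `ℤ/2`-graded space with
products `a_(n) b = prod n a b` and a derivation operator `D` (written `∂` below), both compatible
with the parity, and an even conformal vector `L`. -/
structure ConformalSuperalgebra (R : Type*) [AddCommGroup R] [Module ℂ R] where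
  /-- `parity 0` is the even subspace and `parity 1` the odd subspace. -/
  parity : ZMod 2 → Submodule ℂ R
  parity_internal : DirectSum.IsInternal parity
  prod : ℕ → R →ₗ[ℂ] R →ₗ[ℂ] R
  D : R →ₗ[ℂ] R
  L : R
  prod_parity : ∀ (n : ℕ) (p q : ZMod 2) (a b : R), a ∈ parity p → b ∈ parity q →
    prod n a b ∈ parity (p + q)
  D_parity : ∀ (p : ZMod 2) (a : R), a ∈ parity p → D a ∈ parity p
  /-- Locality. -/
  prod_eventually_zero : ∀ a b : R, ∃ N : ℕ, ∀ n ≥ N, prod n a b = 0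
  /-- `(∂ a)_(n) b = - n a_(n-1) b`. -/
  D_prod : ∀ (n : ℕ) (a b : R), prod n (D a) b = -(n : ℂ) • prod (n - 1) a b
  /-- `a_(n) b = (-1)^{p(a)p(b)} ∑_j (-1)^{j+n+1} ∂^{(j)} (b_(n+j) a)`; by locality only finitely
  many terms are nonzero. -/
  prod_skew : ∀ (n : ℕ) (p q : ZMod 2) (a b : R), a ∈ parity p → b ∈ parity q →
    prod n a b = (-1 : ℂ) ^ (p.val * q.val) •
      ∑ᶠ j : ℕ, ((-1 : ℂ) ^ (j + n + 1) * ((j.factorial : ℂ))⁻¹) •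
        (D ^ j) (prod (n + j) b a)
  /-- `a_(m) (b_(n) c) = ∑_j binom(m,j) (a_(j) b)_(n+m-j) c + (-1)^{p(a)p(b)} b_(n) (a_(m) c)`. -/
  prod_jacobi : ∀ (m n : ℕ) (p q : ZMod 2) (a b c : R), a ∈ parity p → b ∈ parity q →
    prod m a (prod n b c) =
      (∑ j ∈ Finset.range (m + 1), (m.choose j : ℂ) • prod (n + m - j) (prod j a b) c) +
        (-1 : ℂ) ^ (p.val * q.val) • prod n b (prod m a c)
  L_even : L ∈ parity 0
  L_zero_L : prod 0 L L = D L
  L_one_L : prod 1 L L = (2 : ℂ) • L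
  L_two_L : prod 2 L L = 0
  L_zero : prod 0 L = D
  /-- `L_(1)` is diagonalizable. -/
  L_one_diagonalizable : ⨆ k : ℂ, Module.End.eigenspace (prod 1 L) k = ⊤

namespace ConformalSuperalgebra

variable {R : Type*} [AddCommGroup R] [Module ℂ R] (C : ConformalSuperalgebra R)

/-- `R^k`, the space of vectors of conformal weight `k`. -/
def weight (k : ℂ) : Submodule ℂ R := Module.End.eigenspace (C.prod 1 C.L) k

/-- An ideal: a `ℂ[∂]`-submodule closed under left multiplication by all products. -/
def IsIdeal (I : Submodule ℂ R) : Prop :=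
  (∀ x ∈ I, C.D x ∈ I) ∧ ∀ (n : ℕ) (a : R), ∀ x ∈ I, C.prod n a x ∈ I

/-- There are no ideals other than `0` and the whole algebra. -/
def IsSimple : Prop := ∀ I : Submodule ℂ R, C.IsIdeal I → I = ⊥ ∨ I = ⊤

/-- `R` is a superconformal algebra, as witnessed by the finite-dimensional super subspace `F`
with `R = ℂ[∂] F`. -/
structure IsSuperconformalWith (F : Submodule ℂ R) : Prop where
  finiteDimensional : FiniteDimensional ℂ F
  /-- `F` is a `ℤ/2`-graded subspace. -/
  graded : F ≤ (F ⊓ C.parity 0) ⊔ (F ⊓ C.parity 1)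
  generates : ⨆ j : ℕ, F.map (C.D ^ j) = ⊤
  weights : ∀ k : ℂ, C.weight k ≠ ⊥ → ∃ n : ℕ, k = (n : ℂ) / 2
  even_eq : C.parity 0 = ⨆ n : ℕ, C.weight (n : ℂ)
  odd_eq : C.parity 1 = ⨆ n : ℕ, C.weight ((n : ℂ) + 1 / 2)

/-- Physical conformal superalgebras: superconformal algebras generated over `ℂ[∂]` in conformal
weights `2, 3/2, 1, 1/2`, with `L` spanning the weight `2` part of the generating space. -/
def IsPhysical : Prop :=
  ∃ F : Submodule ℂ R, C.IsSuperconformalWith F ∧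
    F ≤ C.weight 2 ⊔ C.weight (3 / 2) ⊔ C.weight 1 ⊔ C.weight (1 / 2) ∧
    F ⊓ C.weight 2 = Submodule.span ℂ {C.L}

/-- The reduced subspace `{x | L_(2) x ∈ R^0}`. -/
def reduced : Submodule ℂ R := (C.weight 0).comap (C.prod 2 C.L)

/-- The reduced vectors of conformal weight `k`. -/
def reducedWeight (k : ℂ) : Submodule ℂ R := C.reduced ⊓ C.weight k

/-- `c` gives a `∂`-decomposition `x = ∑_j ∂^{(j)} x^j` of `x`, with `x^j = c j`: the `0`-part is a
reduced vector, and the other parts are sums of reduced vectors of nonzero weight. -/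
def IsDDecomposition (x : R) (c : ℕ →₀ R) : Prop :=
  c 0 ∈ C.reduced ∧
    (∀ j : ℕ, 0 < j → c j ∈ ⨆ k : {k : ℂ // k ≠ 0}, C.reducedWeight k.1) ∧
    x = c.sum fun j y => ((j.factorial : ℂ))⁻¹ • (C.D ^ j) y

/-- The `0`-part `x^0` of `x`. In a physical conformal superalgebra every vector has exactly one
`∂`-decomposition. -/
noncomputable def zeroPart (x : R) : R :=
  Classical.epsilon fun y => ∃ c : ℕ →₀ R, C.IsDDecomposition x c ∧ c 0 = y

/-- The reduced product of reduced vectors: the `0`-part of `a_(n) b`. -/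
noncomputable def redProd (n : ℕ) (a b : R) : R := C.zeroPart (C.prod n a b)

/-- `V`, the reduced vectors of weight `3/2`. -/
noncomputable def V : Submodule ℂ R := C.reducedWeight (3 / 2)

/-- `F`, the reduced vectors of weight `1/2`. -/
noncomputable def F : Submodule ℂ R := C.reducedWeight (1 / 2)

/-- `B` is the inner product on `V`: `B(u,v) L` is the reduced `0`-th product of `u` and `v`. -/
def IsInnerProduct (B : LinearMap.BilinForm ℂ C.V) : Prop :=
  ∀ u v : C.V, C.redProd 0 (u : R) (v : R) = B u v • C.L

/-- `F³`: the vectors of `F` annihilated by every triple reduced `0`-th product by vectors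
of `V`. -/
def FCubed : Set R :=
  {f | f ∈ C.F ∧ ∀ v₁ ∈ C.V, ∀ v₂ ∈ C.V, ∀ v₃ ∈ C.V,
    C.redProd 0 v₁ (C.redProd 0 v₂ (C.redProd 0 v₃ f)) = 0}

end ConformalSuperalgebra

/-!
Let `R` be physical. Modulo the total derivatives `∂R` the `0`-th product is a Lie superalgebra
action, with `(∂ a)_(0) = 0`, and positivity of the weights for the `sl₂`-triple
`L_(0) = ∂, L_(1), L_(2)` shows that no nonzero reduced vector is a total derivative. Hence the
`0`-part of `x` is the unique reduced vector congruent to `x` modulo `∂R`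
(`IsPhysical.zeroPart_eq`), and a condition on reduced products such as the one defining `F³` says
that an iterated `0`-th product lies in `∂R` (`IsPhysical.mem_FCubed_iff`). The vectors of weight
`2` are `ℂ L ⊕ ∂R¹`, which gives the inner product on `V`, and `R` is generated over `ℂ[∂]` by `L`,
`V`, `R¹` and `F = R^{1/2}`. An ideal that contains `L` is everything, so simplicity means that no
nonzero ideal avoids `L`.

If `R` is simple, consider the candidate `rad` for the largest ideal without `L`: it is generated
over `ℂ[∂]` by the radical `N` of the inner product, by `F³`, and by the `a ∈ R¹` for which
`V_(0) V_(0) a ⊆ ∂R` and `V_(1) a ⊆ F³`. It does not contain `L`, so once it is known to be an ideal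
(`IsPhysical.isIdeal_rad`), it is zero and therefore `N` and `F³` are zero. The point is to show
that products with elements `n ∈ N` stay in `rad`. There are two steps of substance. First,
`v_(0) (w_(0) (u_(1) n))` is multiplied by `-1/2` modulo `∂R` when `w` and `u` are exchanged, so it
vanishes (`IsPhysical.prod_one_radical_mem_annih`). Secondly, `w_(1) (u_(1) n) = n_(1) (w_(1) u)`,
which by skew-symmetry is `± (w_(1) u)_(1) n` modulo `∂R`; a product of the form `a_(1) n` with
`a ∈ R¹` lies in `F³` by the first step
(`IsPhysical.prod_one_prod_one_radical_mem_annih`).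

Conversely let `V ≠ 0`, let the inner product be nondegenerate and `F³ = 0`, and let `I` be an ideal
without `L`. Then `I ∩ R²` consists of total derivatives, so that `I ∩ F` lies in `F³` and `I ∩ V`
in `N`. A vector `a ∈ I ∩ R¹` is therefore annihilated by all products with `V`, hence by
`(u_(0) v)_(1)`, which acts on it by the scalar `(u, v)`, and so `a = 0`
(`IsPhysical.eq_zero_of_prod_V_eq_zero`). In higher weights `I` vanishes by induction, because
`L_(2)` lowers the weight and its kernel meets `∂R` trivially.
-/

/-! ### Consequences of the axioms -/

namespace ConformalSuperalgebra

variable {R : Type*} [AddCommGroup R] [Module ℂ R] (C : ConformalSuperalgebra R)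

theorem mem_weight {k : ℂ} {x : R} : x ∈ C.weight k ↔ C.prod 1 C.L x = k • x :=
  Module.End.mem_eigenspace_iff

/-- A property of vectors that is additive holds everywhere once it holds for homogeneous
vectors. -/
theorem parity_induction {p : R → Prop} (hom : ∀ (q : ZMod 2) (x : R), x ∈ C.parity q → p x)
    (add : ∀ x y, p x → p y → p (x + y)) (x : R) : p x := by
  have hx : x ∈ ⨆ q, C.parity q := by
    rw [C.parity_internal.submodule_iSup_eq_top]; trivial
  exact Submodule.iSup_induction _ (motive := p) hx hom (hom 0 0 (zero_mem _)) add

theorem weight_induction {p : R → Prop} (hom : ∀ (k : ℂ) (x : R), x ∈ C.weight k → p x)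
    (add : ∀ x y, p x → p y → p (x + y)) (x : R) : p x := by
  have hx : x ∈ ⨆ k, Module.End.eigenspace (C.prod 1 C.L) k := by
    rw [C.L_one_diagonalizable]; trivial
  exact Submodule.iSup_induction _ (motive := p) hx hom (hom 0 0 (zero_mem _)) add

/-- The commutator formula for the products with `L`; as `L` is even, no sign occurs and the
second factor need not be homogeneous. -/
theorem L_jacobi (m n : ℕ) (a c : R) :
    C.prod m C.L (C.prod n a c) =
      (∑ j ∈ Finset.range (m + 1),
        (m.choose j : ℂ) • C.prod (n + m - j) (C.prod j C.L a) c) +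
        C.prod n a (C.prod m C.L c) := by
  refine C.parity_induction (p := fun a => C.prod m C.L (C.prod n a c) =
      (∑ j ∈ Finset.range (m + 1),
        (m.choose j : ℂ) • C.prod (n + m - j) (C.prod j C.L a) c) +
        C.prod n a (C.prod m C.L c)) ?_ ?_ a
  · intro q x hx
    rw [C.prod_jacobi m n 0 q C.L x c C.L_even hx]
    simp
  · intro x y hx hy
    simp only [map_add, LinearMap.add_apply, hx, hy, smul_add, Finset.sum_add_distrib]
    abel

theorem D_prod_succ (n : ℕ) (a b : R) :
    C.prod (n + 1) (C.D a) b = -((n : ℂ) + 1) • C.prod n a b := by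
  simpa using C.D_prod (n + 1) a b

theorem D_prod_zero (a b : R) : C.prod 0 (C.D a) b = 0 := by
  simpa using C.D_prod 0 a b

theorem D_apply_prod (n : ℕ) (a c : R) :
    C.D (C.prod n a c) = -(n : ℂ) • C.prod (n - 1) a c + C.prod n a (C.D c) := by
  have h := C.L_jacobi 0 n a c
  simpa [C.L_zero, C.D_prod] using h

theorem prod_D_zero (a c : R) : C.prod 0 a (C.D c) = C.D (C.prod 0 a c) := by
  simpa using (C.D_apply_prod 0 a c).symm

theorem prod_D_succ (n : ℕ) (a c : R) :
    C.prod (n + 1) a (C.D c) = C.D (C.prod (n + 1) a c) + ((n : ℂ) + 1) • C.prod n a c := by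
  rw [C.D_apply_prod (n + 1) a c]
  simp only [Nat.add_sub_cancel, Nat.cast_add, Nat.cast_one]
  module

theorem prod_mem_weight {k l m : ℂ} (n : ℕ) {a b : R} (ha : a ∈ C.weight k)
    (hb : b ∈ C.weight l) (hm : m = k + l - n - 1) : C.prod n a b ∈ C.weight m := by
  rw [mem_weight] at *
  have h := C.L_jacobi 1 n a b
  simp only [Finset.sum_range_succ, Finset.sum_range_zero, C.L_zero, ha, hb] at h
  rw [h, hm, Nat.sub_zero, C.D_prod_succ]
  simp only [Nat.add_sub_cancel, map_smul, LinearMap.smul_apply, Nat.choose_zero_right,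
    Nat.choose_self, Nat.cast_one]
  module

theorem L_mem_weight : C.L ∈ C.weight 2 := C.mem_weight.2 C.L_one_L

theorem D_mem_weight {k m : ℂ} {x : R} (hx : x ∈ C.weight k) (hm : m = k + 1) :
    C.D x ∈ C.weight m := by
  rw [← C.L_zero]
  exact C.prod_mem_weight 0 C.L_mem_weight hx (by rw [hm]; push_cast; ring)

theorem L_two_mem_weight {k m : ℂ} {x : R} (hx : x ∈ C.weight k) (hm : m = k - 1) :
    C.prod 2 C.L x ∈ C.weight m :=
  C.prod_mem_weight 2 C.L_mem_weight hx (by rw [hm]; push_cast; ring)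

theorem L_two_D (x : R) :
    C.prod 2 C.L (C.D x) = C.D (C.prod 2 C.L x) + (2 : ℂ) • C.prod 1 C.L x := by
  have h := C.prod_D_succ 1 C.L x
  rw [h]; norm_num

/-- `L_(2)` commutes past a product with a vector of weight `k`. -/
theorem L_two_prod {k : ℂ} {u : R} (hu : u ∈ C.weight k) (n : ℕ) (x : R) :
    C.prod 2 C.L (C.prod n u x) = (2 * k - n - 2) • C.prod (n + 1) u x
      + C.prod n (C.prod 2 C.L u) x + C.prod n u (C.prod 2 C.L x) := by
  rw [mem_weight] at hu
  have h := C.L_jacobi 2 n u x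
  simp only [Finset.sum_range_succ, Finset.sum_range_zero, C.L_zero, hu] at h
  rw [h, Nat.sub_zero, C.D_prod_succ (n + 1)]
  have e : n + 2 - 1 = n + 1 := rfl
  rw [e]
  simp only [Nat.add_sub_cancel, map_smul, LinearMap.smul_apply, Nat.choose_zero_right,
    Nat.choose_self, Nat.choose_one_right, Nat.cast_one, Nat.cast_ofNat]
  push_cast
  module

/-! ### The Lie superalgebra of `0`-th products modulo total derivatives -/

/-- The space `∂R` of total derivatives. The `0`-th product makes `R / ∂R` a Lie superalgebra;
congruences modulo `∂R` are written as membership of a difference in this subspace. -/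
def der : Submodule ℂ R := LinearMap.range C.D

theorem D_mem_der (x : R) : C.D x ∈ C.der := ⟨x, rfl⟩

theorem prod_zero_mem_der (a : R) {x : R} (hx : x ∈ C.der) : C.prod 0 a x ∈ C.der := by
  obtain ⟨y, rfl⟩ := hx
  rw [C.prod_D_zero]; exact C.D_mem_der _

/-- Skew-symmetry modulo `∂R`: the finite sum in the axiom with its leading term split off. -/
theorem prod_eq_swap_add_der (n : ℕ) {p q : ZMod 2} {a b : R} (ha : a ∈ C.parity p)
    (hb : b ∈ C.parity q) : ∃ y, C.prod n a b =
      (-1 : ℂ) ^ (p.val * q.val + n + 1) • C.prod n b a + C.D y := by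
  obtain ⟨N, hN⟩ := C.prod_eventually_zero b a
  have hsum := C.prod_skew n p q a b ha hb
  rw [finsum_eq_sum_of_support_subset (s := Finset.range (N + 1))] at hsum
  · rw [Finset.sum_range_succ'] at hsum
    refine ⟨(-1 : ℂ) ^ (p.val * q.val) • ∑ k ∈ Finset.range N,
      ((-1 : ℂ) ^ (k + 1 + n + 1) * (((k + 1).factorial : ℂ))⁻¹) •
        (C.D ^ k) (C.prod (n + (k + 1)) b a), ?_⟩
    rw [hsum, map_smul, map_sum]
    simp only [map_smul, pow_succ' C.D, Module.End.mul_apply, pow_zero, Module.End.one_apply,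
      Nat.factorial_zero, Nat.cast_one, inv_one, mul_one, zero_add, add_zero, smul_add]
    rw [smul_smul, ← pow_add, add_comm, add_assoc]
  · intro j hj
    by_contra hj'
    apply hj
    simp only [Finset.coe_range, Set.mem_Iio, not_lt] at hj'
    simp [hN (n + j) (by omega)]

/-! ### `ℂ[∂]`-spans and ideals -/

/-- The `ℂ[∂]`-submodule generated by a subspace. -/
def DSpan (S : Submodule ℂ R) : Submodule ℂ R := ⨆ j : ℕ, S.map (C.D ^ j)

theorem le_DSpan (S : Submodule ℂ R) : S ≤ C.DSpan S := fun y hy =>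
  Submodule.mem_iSup_of_mem 0 ⟨y, hy, rfl⟩

theorem D_mem_DSpan {S : Submodule ℂ R} {y : R} (hy : y ∈ C.DSpan S) : C.D y ∈ C.DSpan S := by
  refine Submodule.iSup_induction _ (motive := fun y => C.D y ∈ C.DSpan S) hy ?_ (by simp) ?_
  · rintro j _ ⟨z, hz, rfl⟩
    refine Submodule.mem_iSup_of_mem (j + 1) ⟨z, hz, ?_⟩
    rw [pow_succ', Module.End.mul_apply]
  · intro a b ha hb
    rw [map_add]; exact Submodule.add_mem _ ha hb

theorem DSpan_le {S T : Submodule ℂ R} (hST : S ≤ T) (hT : ∀ x ∈ T, C.D x ∈ T) :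
    C.DSpan S ≤ T := by
  refine iSup_le fun j => ?_
  rintro _ ⟨x, hx, rfl⟩
  induction j with
  | zero => exact hST hx
  | succ j ih => rw [pow_succ', Module.End.mul_apply]; exact hT _ ih

/-- Elements of an ideal have their weight components in the ideal; this is the linear
independence of eigenvectors, for subspaces stable under `L_(1)`. -/
theorem mem_of_sum_mem {I : Submodule ℂ R} (hI : ∀ x ∈ I, C.prod 1 C.L x ∈ I) (s : Finset ℂ) :
    ∀ m : ℂ → R, (∀ k, m k ∈ C.weight k) → ∑ k ∈ s, m k ∈ I → ∀ k ∈ s, m k ∈ I := by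
  induction s using Finset.induction_on with
  | empty => simp
  | insert a s ha ih =>
    intro m hm hsum
    rw [Finset.sum_insert ha] at hsum
    -- `L_(1) - a` kills the component of weight `a` and rescales the other ones.
    have h1 : ∑ k ∈ s, (k - a) • m k ∈ I := by
      have h := I.sub_mem (hI _ hsum) (I.smul_mem a hsum)
      have e : ∀ k, C.prod 1 C.L (m k) = k • m k := fun k => C.mem_weight.1 (hm k)
      simp only [map_add, map_sum, e, smul_add, Finset.smul_sum] at h
      rw [add_sub_add_left_eq_sub, ← Finset.sum_sub_distrib] at h
      simpa only [sub_smul] using h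
    have h2 : ∀ k ∈ s, m k ∈ I := by
      intro k hk
      have h := ih (fun k => (k - a) • m k) (fun k => Submodule.smul_mem _ _ (hm k)) h1 k hk
      have hne : k - a ≠ 0 := sub_ne_zero.2 (fun h => ha (h ▸ hk))
      exact (I.smul_mem_iff hne).1 h
    have h3 : m a ∈ I := by simpa using I.sub_mem hsum (I.sum_mem h2)
    intro k hk
    rcases Finset.mem_insert.1 hk with rfl | hk
    · exact h3
    · exact h2 k hk

/-- A subspace stable under `L_(1)` vanishes once it contains no nonzero eigenvector. -/
theorem eq_bot_of_weight {I : Submodule ℂ R} (hI : ∀ x ∈ I, C.prod 1 C.L x ∈ I)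
    (h : ∀ k, ∀ x ∈ I, x ∈ C.weight k → x = 0) : I = ⊥ := by
  rw [eq_bot_iff]
  intro x hx
  have hx' : x ∈ ⨆ k, Module.End.eigenspace (C.prod 1 C.L) k := by
    rw [C.L_one_diagonalizable]; trivial
  obtain ⟨m, hm, rfl⟩ := (Submodule.mem_iSup_iff_exists_finsupp _ _).1 hx'
  have h1 := C.mem_of_sum_mem hI m.support m hm hx
  exact Finset.sum_eq_zero fun k hk => h k _ (h1 k hk) (hm k)

variable {C} in
/-- By skew-symmetry an ideal containing `L` contains the image of `L_(1)`. -/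
theorem IsIdeal.L_one_mem {I : Submodule ℂ R} (hI : C.IsIdeal I) (hL : C.L ∈ I) (x : R) :
    C.prod 1 C.L x ∈ I := by
  refine C.parity_induction (p := fun x => C.prod 1 C.L x ∈ I) ?_ ?_ x
  · intro q x hx
    have hD : ∀ (j : ℕ), ∀ y ∈ I, (C.D ^ j) y ∈ I := by
      intro j
      induction j with
      | zero => simp
      | succ j ih => intro y hy; rw [pow_succ, Module.End.mul_apply]; exact ih _ (hI.1 y hy)
    rw [C.prod_skew 1 0 q C.L x C.L_even hx]
    exact I.smul_mem _ (finsum_induction (· ∈ I) I.zero_mem (fun _ _ => I.add_mem)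
      fun j => I.smul_mem _ (hD j _ (hI.2 _ _ _ hL)))
  · intro x y hx hy
    rw [map_add]; exact I.add_mem hx hy

/-! ### Weight components -/

theorem isCompl_weight (k : ℂ) : IsCompl (C.weight k) (⨆ j, ⨆ (_ : j ≠ k), C.weight j) := by
  refine ⟨Module.End.eigenspaces_iSupIndep (C.prod 1 C.L) k, ?_⟩
  rw [codisjoint_iff, eq_top_iff, ← C.L_one_diagonalizable]
  refine iSup_le fun j => ?_
  by_cases h : j = k
  · subst h; exact le_sup_left
  · exact le_sup_of_le_right (le_iSup₂_of_le j h le_rfl)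

/-- The projection onto the vectors of weight `k`. -/
noncomputable def weightProj (k : ℂ) : R →ₗ[ℂ] R := 
  Submodule.projection _ _ (C.isCompl_weight k)

theorem weightProj_mem (k : ℂ) (x : R) : C.weightProj k x ∈ C.weight k :=
  Submodule.projection_apply_mem _ x

theorem weightProj_self {k : ℂ} {x : R} (hx : x ∈ C.weight k) : C.weightProj k x = x :=
  Submodule.projection_apply_of_mem_left _ hx

theorem weightProj_eq_zero {j k : ℂ} {x : R} (hx : x ∈ C.weight j) (hj : j ≠ k) :
    C.weightProj k x = 0 := by
  have h : x ∈ ⨆ j, ⨆ (_ : j ≠ k), C.weight j :=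
    Submodule.mem_iSup_of_mem j (Submodule.mem_iSup_of_mem hj hx)
  exact (Submodule.projection_apply_eq_zero_iff _).2 h

theorem weightProj_D {k m : ℂ} (hm : m = k + 1) (x : R) :
    C.weightProj m (C.D x) = C.D (C.weightProj k x) := by
  refine C.weight_induction (p := fun x => C.weightProj m (C.D x) = C.D (C.weightProj k x))
    ?_ ?_ x
  · intro j x hx
    have hD := C.D_mem_weight hx rfl
    by_cases h : j = k
    · subst h; rw [C.weightProj_self hx, C.weightProj_self (hm ▸ hD)]
    · rw [C.weightProj_eq_zero hx h, map_zero, C.weightProj_eq_zero hD]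
      rw [hm]; exact fun h' => h (add_right_cancel h')
  · intro x y hx hy
    simp only [map_add, hx, hy]

/-! ### The structure of physical conformal superalgebras -/

variable {C}

theorem IsPhysical.eq_zero_of_mem_weight_zero (hC : C.IsPhysical) {x : R}
    (hx : x ∈ C.weight 0) : x = 0 := by
  obtain ⟨G, hG, hGw, -⟩ := hC
  have hj : ∀ j : ℕ, ∀ y ∈ G.map (C.D ^ j), C.weightProj 0 y = 0 := by
    intro j
    have hpow : ∀ {k : ℂ} {y : R}, y ∈ C.weight k → (C.D ^ j) y ∈ C.weight (k + j) := by
      induction j with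
      | zero => intro k y hy; simpa using hy
      | succ j ih =>
        intro k y hy
        rw [pow_succ', Module.End.mul_apply]
        exact C.D_mem_weight (ih hy) (by push_cast; ring)
    rintro _ ⟨y, hy, rfl⟩
    have hy' := hGw hy
    simp only [Submodule.mem_sup] at hy'
    obtain ⟨_, ⟨_, ⟨a, ha, b, hb, rfl⟩, c, hc, rfl⟩, d, hd, rfl⟩ := hy'
    have hre : ∀ r : ℝ, 0 < r → (r : ℂ) + j ≠ 0 := by
      intro r hr h
      have : r + j = 0 := by exact_mod_cast h
      have : (0 : ℝ) ≤ j := j.cast_nonneg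
      linarith
    rw [map_add, map_add, map_add, map_add, map_add, map_add,
      C.weightProj_eq_zero (hpow ha) (by simpa using hre 2 (by norm_num)),
      C.weightProj_eq_zero (hpow hb) (by simpa using hre (3 / 2) (by norm_num)),
      C.weightProj_eq_zero (hpow hc) (by simpa using hre 1 (by norm_num)),
      C.weightProj_eq_zero (hpow hd) (by simpa using hre (1 / 2) (by norm_num))]
    simp
  have hx' : x ∈ ⨆ j : ℕ, G.map (C.D ^ j) := by rw [hG.generates]; trivial
  rw [← C.weightProj_self hx]
  exact Submodule.iSup_induction _ (motive := fun y => C.weightProj 0 y = 0) hx' hj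
    (map_zero _) (fun x y h1 h2 => by rw [map_add, h1, h2, add_zero])

/-- The weights of a physical conformal superalgebra are positive half-integers. -/
theorem IsPhysical.weight_cases (hC : C.IsPhysical) {k : ℂ} {x : R} (hx : x ∈ C.weight k)
    (h0 : x ≠ 0) : ∃ n : ℕ, 0 < n ∧ k = (n : ℂ) / 2 := by
  have hz := fun h => h0 (hC.eq_zero_of_mem_weight_zero h)
  obtain ⟨G, hG, -⟩ := hC
  obtain ⟨n, rfl⟩ := hG.weights k (fun h => h0 (by rw [h] at hx; exact hx))
  refine ⟨n, Nat.pos_of_ne_zero ?_, rfl⟩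
  rintro rfl
  apply hz; simpa using hx

theorem IsPhysical.eq_zero_of_nonpos (hC : C.IsPhysical) {k : ℂ} {x : R} (hx : x ∈ C.weight k)
    (z : ℤ) (hz : z ≤ 0) (hk : k = (z : ℂ) / 2) : x = 0 := by
  by_contra h0
  obtain ⟨n, hn, h⟩ := hC.weight_cases hx h0
  rw [hk] at h
  have h' : (z : ℂ) = ((n : ℤ) : ℂ) := by
    push_cast
    linear_combination 2 * h
  have : z = n := by exact_mod_cast h'
  omega

theorem IsPhysical.mem_reduced (hC : C.IsPhysical) {x : R} :
    x ∈ C.reduced ↔ C.prod 2 C.L x = 0 :=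
  ⟨fun h => hC.eq_zero_of_mem_weight_zero h, fun h => by
    change C.prod 2 C.L x ∈ C.weight 0
    rw [h]; exact zero_mem _⟩

/-- Positivity for the `sl₂`-triple `L_(0), L_(1), L_(2)`: as `L_(2)` lowers weights and all
weights are positive, `∂ L_(2)` has no negative eigenvalues. -/
theorem IsPhysical.eq_zero_of_D_L_two (hC : C.IsPhysical) (n : ℕ) :
    ∀ y ∈ C.weight ((n : ℂ) / 2), ∀ c : ℝ, 0 < c →
      C.D (C.prod 2 C.L y) + (c : ℂ) • y = 0 → y = 0 := by
  induction n using Nat.strong_induction_on with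
  | _ n ih =>
    intro y hy c hc h
    have hE : C.prod 2 C.L y = 0 := by
      have hw := C.L_two_mem_weight hy rfl
      rcases le_or_gt n 2 with hn | hn
      · exact hC.eq_zero_of_nonpos hw (n - 2) (by omega) (by push_cast; ring)
      · obtain ⟨m, rfl⟩ := Nat.exists_eq_add_of_lt hn
        have hw' : C.prod 2 C.L y ∈ C.weight (((m + 1 : ℕ) : ℂ) / 2) := by
          convert hw using 1; push_cast; ring_nf
        refine ih (m + 1) (by omega) _ hw' (c + (m + 1)) (by positivity) ?_
        have h2 := congrArg (C.prod 2 C.L) h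
        rw [map_add, map_smul, C.L_two_D, C.mem_weight.1 hw', map_zero] at h2
        rw [← h2]; push_cast; module
    rw [hE, map_zero, zero_add] at h
    exact (smul_eq_zero.1 h).resolve_left (by exact_mod_cast hc.ne')

theorem IsPhysical.L_two_D_injective (hC : C.IsPhysical) {y : R}
    (h : C.prod 2 C.L (C.D y) = 0) : y = 0 := by
  have hcomm : ∀ x, C.prod 2 C.L (C.D (C.prod 1 C.L x)) =
      C.prod 1 C.L (C.prod 2 C.L (C.D x)) := by
    refine C.weight_induction ?_ ?_
    · intro k x hx
      have hw : C.prod 2 C.L (C.D x) ∈ C.weight k :=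
        C.L_two_mem_weight (C.D_mem_weight hx rfl) (by ring)
      rw [C.mem_weight.1 hx, C.mem_weight.1 hw, map_smul, map_smul]
    · intro x y hx hy
      simp only [map_add, hx, hy]
  have hbot : LinearMap.ker ((C.prod 2 C.L).comp C.D) = ⊥ := by
    refine C.eq_bot_of_weight ?_ ?_
    · intro x hx
      rw [LinearMap.mem_ker, LinearMap.comp_apply] at *
      rw [hcomm, hx, map_zero]
    · intro k x hx hk
      by_contra h0
      obtain ⟨n, hn, rfl⟩ := hC.weight_cases hk h0
      refine h0 (hC.eq_zero_of_D_L_two n x hk n (by exact_mod_cast hn) ?_)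
      rw [LinearMap.mem_ker, LinearMap.comp_apply, C.L_two_D, C.mem_weight.1 hk] at hx
      rw [← hx]; push_cast; module
  have : y ∈ LinearMap.ker ((C.prod 2 C.L).comp C.D) := h
  rw [hbot] at this
  exact this

/-- No nonzero reduced vector is a total derivative. -/
theorem IsPhysical.eq_zero_of_mem_der (hC : C.IsPhysical) {x : R} (hE : C.prod 2 C.L x = 0)
    (hx : x ∈ C.der) : x = 0 := by
  obtain ⟨y, rfl⟩ := hx
  rw [hC.L_two_D_injective hE, map_zero]

theorem IsPhysical.L_two_half (hC : C.IsPhysical) {x : R} (hx : x ∈ C.weight (1 / 2)) :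
    C.prod 2 C.L x = 0 :=
  hC.eq_zero_of_nonpos (C.L_two_mem_weight hx rfl) (-1) (by norm_num) (by norm_num)

theorem IsPhysical.L_two_one (hC : C.IsPhysical) {x : R} (hx : x ∈ C.weight 1) :
    C.prod 2 C.L x = 0 :=
  hC.eq_zero_of_nonpos (C.L_two_mem_weight hx rfl) 0 (by norm_num) (by norm_num)

theorem IsPhysical.mem_V (hC : C.IsPhysical) {x : R} :
    x ∈ C.V ↔ x ∈ C.weight (3 / 2) ∧ C.prod 2 C.L x = 0 := by
  rw [V, reducedWeight, Submodule.mem_inf, hC.mem_reduced, and_comm]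

theorem IsPhysical.mem_F (hC : C.IsPhysical) {x : R} : x ∈ C.F ↔ x ∈ C.weight (1 / 2) := by
  rw [F, reducedWeight, Submodule.mem_inf, hC.mem_reduced]
  exact ⟨fun h => h.2, fun h => ⟨hC.L_two_half h, h⟩⟩

/-- A vector of weight `3/2` is the sum of a vector of `V` and `∂ (L_(2) x)`. -/
theorem IsPhysical.sub_mem_V (hC : C.IsPhysical) {x : R} (hx : x ∈ C.weight (3 / 2)) :
    x - C.D (C.prod 2 C.L x) ∈ C.V := by
  have hE : C.prod 2 C.L x ∈ C.weight (1 / 2) := C.L_two_mem_weight hx (by norm_num)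
  refine hC.mem_V.2 ⟨Submodule.sub_mem _ hx (C.D_mem_weight hE (by norm_num)), ?_⟩
  rw [map_sub, C.L_two_D, C.mem_weight.1 hE, hC.L_two_half hE, map_zero]
  module

theorem IsPhysical.half_mem_parity (hC : C.IsPhysical) {x : R} (hx : x ∈ C.weight (1 / 2)) :
    x ∈ C.parity 1 := by
  obtain ⟨G, hG, -⟩ := hC
  rw [hG.odd_eq]
  exact Submodule.mem_iSup_of_mem 0 (by simpa using hx)

theorem IsPhysical.one_mem_parity (hC : C.IsPhysical) {x : R} (hx : x ∈ C.weight 1) :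
    x ∈ C.parity 0 := by
  obtain ⟨G, hG, -⟩ := hC
  rw [hG.even_eq]
  exact Submodule.mem_iSup_of_mem 1 (by simpa using hx)

theorem IsPhysical.threeHalves_mem_parity (hC : C.IsPhysical) {x : R}
    (hx : x ∈ C.weight (3 / 2)) : x ∈ C.parity 1 := by
  obtain ⟨G, hG, -⟩ := hC
  rw [hG.odd_eq]
  refine Submodule.mem_iSup_of_mem 1 ?_
  convert hx using 2; norm_num

/-- The vectors of weight `2` are spanned by `L` and derivatives of vectors of weight `1`. The
generating space need not be graded by weight; its grading by parity is what is used here. -/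
theorem IsPhysical.exists_eq_of_mem_weight_two (hC : C.IsPhysical) {y : R}
    (hy : y ∈ C.weight 2) : ∃ c : ℂ, ∃ b ∈ C.weight 1, y = c • C.L + C.D b := by
  have hC' := hC
  obtain ⟨G, hG, hGw, hGL⟩ := hC
  have hyG : ∃ f ∈ G, ∃ r, y = f + C.D r := by
    have : (⊤ : Submodule ℂ R) ≤ G ⊔ C.der := by
      rw [← hG.generates]
      refine iSup_le fun j => ?_
      cases j with
      | zero => rintro _ ⟨x, hx, rfl⟩; exact Submodule.mem_sup_left hx
      | succ j =>
        refine le_sup_of_le_right ?_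
        rintro _ ⟨x, -, rfl⟩
        rw [pow_succ', Module.End.mul_apply]; exact C.D_mem_der _
    obtain ⟨f, hf, _, ⟨r, rfl⟩, h⟩ := Submodule.mem_sup.1 (this (Submodule.mem_top (x := y)))
    exact ⟨f, hf, r, h.symm⟩
  obtain ⟨f, hf, r, hyf⟩ := hyG
  obtain ⟨f₀, ⟨hf₀G, hf₀⟩, f₁, ⟨hf₁G, hf₁⟩, rfl⟩ := Submodule.mem_sup.1 (hG.graded hf)
  have hodd : ∀ n : ℕ, C.weightProj n f₁ = 0 := by
    intro n
    rw [hG.odd_eq] at hf₁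
    refine Submodule.iSup_induction _ (motive := fun y => C.weightProj n y = 0) hf₁ ?_
      (map_zero _) (fun x y h1 h2 => by rw [map_add, h1, h2, add_zero])
    intro m x hx
    refine C.weightProj_eq_zero hx fun h => ?_
    have h' : ((2 * m + 1 : ℕ) : ℂ) = ((2 * n : ℕ) : ℂ) := by
      push_cast; linear_combination 2 * h
    have := Nat.cast_injective h'
    omega
  have heven : ∀ n : ℕ, C.weightProj ((n : ℂ) + 1 / 2) f₀ = 0 := by
    intro n
    rw [hG.even_eq] at hf₀
    refine Submodule.iSup_induction _ (motive := fun y => C.weightProj ((n : ℂ) + 1 / 2) y = 0)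
      hf₀ ?_ (map_zero _) (fun x y h1 h2 => by rw [map_add, h1, h2, add_zero])
    intro m x hx
    refine C.weightProj_eq_zero hx fun h => ?_
    have h' : ((2 * m : ℕ) : ℂ) = ((2 * n + 1 : ℕ) : ℂ) := by
      push_cast; linear_combination 2 * h
    have := Nat.cast_injective h'
    omega
  have h1 : C.weightProj 1 f₀ = 0 := by
    have h := congrArg (C.weightProj 1) hyf
    have hr : C.weightProj 0 r = 0 := hC'.eq_zero_of_mem_weight_zero (C.weightProj_mem 0 r)
    have ho := hodd 1
    rw [Nat.cast_one] at ho
    rw [C.weightProj_eq_zero hy (by norm_num), map_add, map_add,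
      C.weightProj_D (k := 0) (by norm_num), hr, ho, map_zero, add_zero, add_zero] at h
    exact h.symm
  have h2 : f₀ ∈ C.weight 2 := by
    have hw := hGw hf₀G
    simp only [Submodule.mem_sup] at hw
    obtain ⟨_, ⟨_, ⟨a, ha, b, hb, rfl⟩, c, hc, rfl⟩, d, hd, rfl⟩ := hw
    have e1 := heven 1
    have e0 := heven 0
    rw [show ((1 : ℕ) : ℂ) + 1 / 2 = 3 / 2 by norm_num] at e1
    rw [show ((0 : ℕ) : ℂ) + 1 / 2 = 1 / 2 by norm_num] at e0
    simp only [map_add] at h1 e1 e0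
    rw [C.weightProj_eq_zero ha (by norm_num), C.weightProj_eq_zero hb (by norm_num),
      C.weightProj_self hc, C.weightProj_eq_zero hd (by norm_num), add_zero, zero_add,
      zero_add] at h1
    rw [C.weightProj_eq_zero ha (by norm_num), C.weightProj_self hb,
      C.weightProj_eq_zero hc (by norm_num), C.weightProj_eq_zero hd (by norm_num), add_zero,
      zero_add, add_zero] at e1
    rw [C.weightProj_eq_zero ha (by norm_num), C.weightProj_eq_zero hb (by norm_num),
      C.weightProj_eq_zero hc (by norm_num), C.weightProj_self hd, add_zero, zero_add,
      zero_add] at e0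
    rw [h1, e1, e0]; simpa using ha
  have h3 : f₀ ∈ Submodule.span ℂ {C.L} := hGL ▸ ⟨hf₀G, h2⟩
  obtain ⟨c, hc⟩ := Submodule.mem_span_singleton.1 h3
  refine ⟨c, C.weightProj 1 r, C.weightProj_mem 1 r, ?_⟩
  have h := congrArg (C.weightProj 2) hyf
  have ho := hodd 2
  rw [Nat.cast_ofNat] at ho
  rw [C.weightProj_self hy, map_add, map_add, C.weightProj_D (k := 1) (by norm_num), ho,
    C.weightProj_self h2, add_zero] at h
  rw [hc, h]

/-- The reduced vectors of weight at most `2` generate the algebra over `ℂ[∂]`. -/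
theorem IsPhysical.eq_top_of_generators (hC : C.IsPhysical) {S : Submodule ℂ R}
    (hD : ∀ x ∈ S, C.D x ∈ S) (hL : C.L ∈ S) (hV : C.V ≤ S) (h1 : C.weight 1 ≤ S)
    (hh : C.weight (1 / 2) ≤ S) : S = ⊤ := by
  have h2 : C.weight 2 ≤ S := by
    intro y hy
    obtain ⟨c, b, hb, rfl⟩ := hC.exists_eq_of_mem_weight_two hy
    exact S.add_mem (S.smul_mem c hL) (hD b (h1 hb))
  have h3 : C.weight (3 / 2) ≤ S := by
    intro y hy
    have := S.add_mem (hV (hC.sub_mem_V hy))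
      (hD _ (hh (C.L_two_mem_weight hy (m := 1 / 2) (by norm_num))))
    simpa using this
  obtain ⟨G, hG, hGw, -⟩ := hC
  have hGS : G ≤ S := hGw.trans (sup_le (sup_le (sup_le h2 h3) h1) hh)
  rw [eq_top_iff, ← hG.generates]
  exact C.DSpan_le hGS hD

theorem IsPhysical.mem_der_of_weight (hC : C.IsPhysical) {n : ℕ} (hn : 4 < n) {x : R}
    (hx : x ∈ C.weight ((n : ℂ) / 2)) : x ∈ C.der := by
  have htop : C.der.comap (C.weightProj ((n : ℂ) / 2)) = ⊤ := by
    have h0 : ∀ m : ℕ, m ≤ 4 → C.weight ((m : ℂ) / 2) ≤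
        C.der.comap (C.weightProj ((n : ℂ) / 2)) := by
      intro m hm y hy
      rw [Submodule.mem_comap, C.weightProj_eq_zero hy]
      · exact zero_mem _
      · intro h
        have h' : (m : ℂ) = n := by linear_combination 2 * h
        have := Nat.cast_injective h'
        omega
    refine hC.eq_top_of_generators ?_ ?_ ?_ ?_ ?_
    · intro y _
      rw [Submodule.mem_comap, C.weightProj_D (k := (n : ℂ) / 2 - 1) (by ring)]
      exact C.D_mem_der _
    · exact h0 4 (by norm_num) (by convert C.L_mem_weight using 2; norm_num)
    · exact fun y hy => h0 3 (by norm_num) (by simpa using (hC.mem_V.1 hy).1)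
    · exact fun y hy => h0 2 (by norm_num) (by simpa using hy)
    · exact fun y hy => h0 1 (by norm_num) (by simpa using hy)
  have h : x ∈ C.der.comap (C.weightProj ((n : ℂ) / 2)) := by rw [htop]; trivial
  rwa [Submodule.mem_comap, C.weightProj_self hx] at h

/-! ### Zero parts -/

theorem IsPhysical.exists_dDecomposition (hC : C.IsPhysical) (x : R) :
    ∃ c, C.IsDDecomposition x c := by
  set Q : Submodule ℂ R := ⨆ k : {k : ℂ // k ≠ 0}, C.reducedWeight k.1 with hQ
  have hred : ∀ (k : ℂ), k ≠ 0 → ∀ x ∈ C.weight k, C.prod 2 C.L x = 0 → x ∈ Q := fun k hk x hx h =>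
    Submodule.mem_iSup_of_mem ⟨k, hk⟩ ⟨hC.mem_reduced.2 h, hx⟩
  have hQS : Q ≤ C.DSpan Q := C.le_DSpan Q
  have htop : C.DSpan Q = ⊤ := by
    refine hC.eq_top_of_generators (fun y hy => C.D_mem_DSpan hy) ?_ ?_ ?_ ?_
    · exact hQS (hred 2 (by norm_num) _ C.L_mem_weight C.L_two_L)
    · exact fun y hy => hQS (hred _ (by norm_num) y (hC.mem_V.1 hy).1 (hC.mem_V.1 hy).2)
    · exact fun y hy => hQS (hred _ (by norm_num) y hy (hC.L_two_one hy))
    · exact fun y hy => hQS (hred _ (by norm_num) y hy (hC.L_two_half hy))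
  have hx : x ∈ C.DSpan Q := by rw [htop]; trivial
  obtain ⟨m, hm, rfl⟩ := (Submodule.mem_iSup_iff_exists_finsupp _ _).1 hx
  choose g hg hgm using hm
  classical
  refine ⟨Finsupp.onFinset m.support (fun j => if j ∈ m.support then (j.factorial : ℂ) • g j else 0)
    (fun j hj => by by_contra h; simp [h] at hj), ?_, ?_, ?_⟩
  · have h0 : Q ≤ C.reduced := iSup_le fun k => inf_le_left
    refine h0 ?_
    simp only [Finsupp.onFinset_apply]
    split_ifs
    · exact Q.smul_mem _ (hg 0)
    · exact Q.zero_mem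
  · intro j _
    simp only [Finsupp.onFinset_apply]
    split_ifs
    · exact Q.smul_mem _ (hg j)
    · exact Q.zero_mem
  · rw [Finsupp.onFinset_sum _ (fun j => by simp), Finsupp.sum]
    refine Finset.sum_congr rfl fun j hj => ?_
    rw [if_pos hj, map_smul, smul_smul, inv_mul_cancel₀ (by exact_mod_cast j.factorial_ne_zero),
      one_smul, hgm]

theorem IsPhysical.zeroPart_spec (hC : C.IsPhysical) (x : R) :
    C.prod 2 C.L (C.zeroPart x) = 0 ∧ x - C.zeroPart x ∈ C.der := by
  have hex : ∃ y, ∃ c : ℕ →₀ R, C.IsDDecomposition x c ∧ c 0 = y := by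
    obtain ⟨c, hc⟩ := hC.exists_dDecomposition x
    exact ⟨c 0, c, hc, rfl⟩
  obtain ⟨c, ⟨h0, -, hx⟩, hz⟩ := Classical.epsilon_spec hex
  change c 0 = C.zeroPart x at hz
  rw [← hz]
  refine ⟨hC.mem_reduced.1 h0, ?_⟩
  have h : x = ∑ j ∈ insert 0 c.support, ((j.factorial : ℂ))⁻¹ • (C.D ^ j) (c j) := by
    conv_lhs => rw [hx]
    exact Finsupp.sum_of_support_subset _ (Finset.subset_insert _ _) _ (fun j _ => by simp)
  rw [h, ← Finset.add_sum_erase _ _ (Finset.mem_insert_self 0 c.support)]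
  simp only [Nat.factorial_zero, Nat.cast_one, inv_one, pow_zero, Module.End.one_apply, one_smul,
    add_sub_cancel_left]
  refine Submodule.sum_mem _ fun j hj => Submodule.smul_mem _ _ ?_
  obtain ⟨i, rfl⟩ := Nat.exists_eq_succ_of_ne_zero (Finset.ne_of_mem_erase hj)
  rw [pow_succ', Module.End.mul_apply]; exact C.D_mem_der _

/-- The `0`-part is the unique reduced representative modulo `∂R`. -/
theorem IsPhysical.zeroPart_eq (hC : C.IsPhysical) {x y : R} (hy : C.prod 2 C.L y = 0)
    (hxy : x - y ∈ C.der) : C.zeroPart x = y := by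
  obtain ⟨h1, h2⟩ := hC.zeroPart_spec x
  refine sub_eq_zero.1 (hC.eq_zero_of_mem_der (by rw [map_sub, h1, hy, sub_zero]) ?_)
  have := Submodule.sub_mem _ hxy h2
  simpa using this

theorem IsPhysical.redProd_eq_zero_iff (hC : C.IsPhysical) (u x : R) :
    C.redProd 0 u x = 0 ↔ C.prod 0 u x ∈ C.der := by
  constructor
  · intro h
    have h2 := (hC.zeroPart_spec (C.prod 0 u x)).2
    change C.prod 0 u x - C.redProd 0 u x ∈ C.der at h2
    rwa [h, sub_zero] at h2
  · exact fun h => hC.zeroPart_eq (map_zero _) (by rwa [sub_zero])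

theorem IsPhysical.prod_zero_zeroPart (hC : C.IsPhysical) (u x : R) :
    C.prod 0 u x - C.prod 0 u (C.zeroPart x) ∈ C.der := by
  rw [← map_sub]; exact C.prod_zero_mem_der u (hC.zeroPart_spec x).2

theorem IsPhysical.mem_FCubed (hC : C.IsPhysical) {f : R} :
    f ∈ C.FCubed ↔ f ∈ C.weight (1 / 2) ∧ ∀ u ∈ C.V, ∀ v ∈ C.V, ∀ w ∈ C.V,
      C.prod 0 u (C.prod 0 v (C.prod 0 w f)) ∈ C.der := by
  change (f ∈ C.F ∧ _) ↔ _
  rw [hC.mem_F]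
  refine and_congr_right fun _ => forall₂_congr fun u _ => forall₂_congr fun v _ =>
    forall₂_congr fun w _ => ?_
  rw [hC.redProd_eq_zero_iff]
  have h1 : C.prod 0 u (C.prod 0 v (C.prod 0 w f)) - C.prod 0 u (C.prod 0 v (C.redProd 0 w f))
      ∈ C.der := by
    rw [← map_sub]; exact C.prod_zero_mem_der u (hC.prod_zero_zeroPart v _)
  have h2 := Submodule.add_mem _ h1 (hC.prod_zero_zeroPart u (C.prod 0 v (C.redProd 0 w f)))
  rw [sub_add_sub_cancel] at h2
  change _ - C.prod 0 u (C.redProd 0 v (C.redProd 0 w f)) ∈ C.der at h2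
  exact ⟨fun h => by simpa using Submodule.add_mem _ h2 h,
    fun h => by simpa using Submodule.sub_mem _ h h2⟩

variable (C)

/-! ### Commutation relations among the generators -/

theorem odd_zero_odd (n : ℕ) {a b : R} (ha : a ∈ C.parity 1) (hb : b ∈ C.parity 1) (c : R) :
    C.prod 0 a (C.prod n b c) = C.prod n (C.prod 0 a b) c - C.prod n b (C.prod 0 a c) := by
  have h := C.prod_jacobi 0 n 1 1 a b c ha hb
  have e : (1 : ZMod 2).val = 1 := rfl
  simp only [e, zero_add, Finset.sum_range_one, Nat.choose_self, Nat.cast_one, one_smul,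
    add_zero, Nat.sub_zero, mul_one, pow_one] at h
  rw [h]; module

theorem odd_one_odd (n : ℕ) {a b : R} (ha : a ∈ C.parity 1) (hb : b ∈ C.parity 1) (c : R) :
    C.prod 1 a (C.prod n b c) = C.prod (n + 1) (C.prod 0 a b) c + C.prod n (C.prod 1 a b) c
      - C.prod n b (C.prod 1 a c) := by
  have h := C.prod_jacobi 1 n 1 1 a b c ha hb
  have e : (1 : ZMod 2).val = 1 := rfl
  simp only [e, Finset.sum_range_succ, Finset.sum_range_zero, Nat.choose_self,
    Nat.choose_zero_right, Nat.cast_one, one_smul, zero_add, Nat.sub_zero, mul_one, pow_one,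
    Nat.add_sub_cancel] at h
  rw [h]; module

theorem zero_even (n : ℕ) {p : ZMod 2} {a b : R} (ha : a ∈ C.parity p) (hb : b ∈ C.parity 0)
    (c : R) :
    C.prod 0 a (C.prod n b c) = C.prod n (C.prod 0 a b) c + C.prod n b (C.prod 0 a c) := by
  simpa using C.prod_jacobi 0 n p 0 a b c ha hb

theorem even_zero (n : ℕ) {p : ZMod 2} {a b : R} (ha : a ∈ C.parity 0) (hb : b ∈ C.parity p)
    (c : R) :
    C.prod 0 a (C.prod n b c) = C.prod n (C.prod 0 a b) c + C.prod n b (C.prod 0 a c) := by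
  simpa using C.prod_jacobi 0 n 0 p a b c ha hb

variable {C}

/-- A product vanishes when its weight, recorded as a half-integer, is not positive. -/
theorem IsPhysical.prod_eq_zero (hC : C.IsPhysical) {k l : ℂ} {a b : R} (ha : a ∈ C.weight k)
    (hb : b ∈ C.weight l) (n : ℕ) (z : ℤ) (hz : z ≤ 0) (h : k + l - n - 1 = (z : ℂ) / 2) :
    C.prod n a b = 0 :=
  hC.eq_zero_of_nonpos (C.prod_mem_weight n ha hb rfl) z hz h

theorem IsPhysical.exists_eq_D (hC : C.IsPhysical) {y : R} (hy : y ∈ C.weight 2)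
    (hd : y ∈ C.der) : ∃ b ∈ C.weight 1, y = C.D b := by
  obtain ⟨c, b, hb, rfl⟩ := hC.exists_eq_of_mem_weight_two hy
  have h1 : c • C.L ∈ C.der := by
    simpa using Submodule.sub_mem _ hd (C.D_mem_der b)
  have h2 := hC.eq_zero_of_mem_der (by rw [map_smul, C.L_two_L, smul_zero]) h1
  exact ⟨b, hb, by rw [h2, zero_add]⟩

/-- For `u, v` of weight `3/2` the operator `(u_(0) v)_(1)` is a combination of `L_(1)` and some
`b_(0)` with `b` of weight `1`. -/
theorem IsPhysical.prod_one_prod_mem (hC : C.IsPhysical) {S : Submodule ℂ R}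
    (hS : ∀ a ∈ C.weight 1, ∀ x ∈ S, C.prod 0 a x ∈ S) {u v : R} (hu : u ∈ C.weight (3 / 2))
    (hv : v ∈ C.weight (3 / 2)) {k : ℂ} {x : R} (hx : x ∈ C.weight k) (hxS : x ∈ S) :
    C.prod 1 (C.prod 0 u v) x ∈ S := by
  obtain ⟨c, b, hb, h⟩ := hC.exists_eq_of_mem_weight_two
    (C.prod_mem_weight (m := 2) 0 hu hv (by norm_num))
  have e := C.D_prod_succ 0 b x
  rw [h, map_add, map_smul, LinearMap.add_apply, LinearMap.smul_apply, C.mem_weight.1 hx, e]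
  exact S.add_mem (S.smul_mem _ (S.smul_mem _ hxS)) (S.smul_mem _ (hS b hb x hxS))

theorem IsPhysical.prod_one_swap (hC : C.IsPhysical) {u v : R} (hu : u ∈ C.weight (3 / 2))
    (hv : v ∈ C.weight (3 / 2)) : C.prod 1 u v = -C.prod 1 v u := by
  obtain ⟨y, hy⟩ := C.prod_eq_swap_add_der 1 (hC.threeHalves_mem_parity hu)
    (hC.threeHalves_mem_parity hv)
  have e : (1 : ZMod 2).val = 1 := rfl
  have h : C.prod 1 u v + C.prod 1 v u = C.D y := by
    rw [hy, e]; norm_num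
  have hw : C.prod 1 u v + C.prod 1 v u ∈ C.weight 1 :=
    Submodule.add_mem _ (C.prod_mem_weight 1 hu hv (by norm_num))
      (C.prod_mem_weight 1 hv hu (by norm_num))
  have h0 := hC.eq_zero_of_mem_der (hC.L_two_one hw) (h ▸ C.D_mem_der y)
  exact eq_neg_of_add_eq_zero_left h0

theorem IsPhysical.prod_zero_swap (hC : C.IsPhysical) {u v : R} (hu : u ∈ C.weight (3 / 2))
    (hv : v ∈ C.weight (3 / 2)) : C.prod 0 u v - C.prod 0 v u ∈ C.der := by
  obtain ⟨y, hy⟩ := C.prod_eq_swap_add_der 0 (hC.threeHalves_mem_parity hu)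
    (hC.threeHalves_mem_parity hv)
  have e : (1 : ZMod 2).val = 1 := rfl
  rw [hy, e]; norm_num; exact C.D_mem_der y

variable (C)

/-! ### Vectors annihilated by iterated `0`-th products -/

/-- The vectors whose `0`-th products with all vectors of weight `3/2` lie in `S`. -/
noncomputable def lower (S : Submodule ℂ R) : Submodule ℂ R :=
  ⨅ u : C.weight (3 / 2), S.comap (C.prod 0 u.1)

/-- The vectors that become total derivatives under every `k`-fold `0`-th product by vectors of
weight `3/2`. -/
noncomputable def annih : ℕ → Submodule ℂ R
  | 0 => C.der
  | k + 1 => C.lower (annih k)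

theorem mem_annih_succ {k : ℕ} {x : R} :
    x ∈ C.annih (k + 1) ↔ ∀ u ∈ C.weight (3 / 2), C.prod 0 u x ∈ C.annih k := by
  simp [annih, lower]

theorem der_le_annih (k : ℕ) : C.der ≤ C.annih k := by
  induction k with
  | zero => exact le_rfl
  | succ k ih =>
    exact fun x hx => C.mem_annih_succ.2 fun u _ => ih (C.prod_zero_mem_der u hx)

variable {C}

/-- Testing against `V` suffices, as `(∂ f)_(0) = 0`. -/
theorem IsPhysical.mem_annih_succ_of_V (hC : C.IsPhysical) {k : ℕ} {x : R}
    (h : ∀ u ∈ C.V, C.prod 0 u x ∈ C.annih k) : x ∈ C.annih (k + 1) := by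
  refine C.mem_annih_succ.2 fun u hu => ?_
  have := h _ (hC.sub_mem_V hu)
  rwa [map_sub, LinearMap.sub_apply, C.D_prod_zero, sub_zero] at this

theorem IsPhysical.prod_zero_mem_annih (hC : C.IsPhysical) (k : ℕ) :
    ∀ a ∈ C.weight 1, ∀ x ∈ C.annih k, C.prod 0 a x ∈ C.annih k := by
  induction k with
  | zero => exact fun a _ x hx => C.prod_zero_mem_der a hx
  | succ k ih =>
    intro a ha x hx
    rw [mem_annih_succ] at *
    intro u hu
    have h := C.even_zero 0 (hC.one_mem_parity ha) (hC.threeHalves_mem_parity hu) x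
    have h' : C.prod 0 u (C.prod 0 a x) =
        C.prod 0 a (C.prod 0 u x) - C.prod 0 (C.prod 0 a u) x := by rw [h]; abel
    rw [h']
    exact Submodule.sub_mem _ (ih a ha _ (hx u hu))
      (hx _ (C.prod_mem_weight 0 ha hu (by norm_num)))

theorem IsPhysical.half_prod_mem_annih (hC : C.IsPhysical) {f : R} (hf : f ∈ C.weight (1 / 2))
    (k : ℕ) : ∀ x ∈ C.annih k, C.prod 0 f x ∈ C.annih (k + 1) := by
  induction k with
  | zero => exact fun x hx => C.der_le_annih 1 (C.prod_zero_mem_der f hx)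
  | succ k ih =>
    intro x hx
    refine C.mem_annih_succ.2 fun u hu => ?_
    rw [C.odd_zero_odd 0 (hC.threeHalves_mem_parity hu) (hC.half_mem_parity hf)]
    exact Submodule.sub_mem _
      (hC.prod_zero_mem_annih _ _ (C.prod_mem_weight 0 hu hf (by norm_num)) _ hx)
      (ih _ (C.mem_annih_succ.1 hx u hu))

/-! ### The radical of the inner product -/

theorem IsPhysical.exists_prod_zero_eq_D (hC : C.IsPhysical) {n v : R} (hn : n ∈ C.V)
    (hn1 : n ∈ C.annih 1) (hv : v ∈ C.V) :
    ∃ c ∈ C.weight 1, C.prod 0 v n = C.D c ∧ (2 : ℂ) • c = C.prod 1 v n := by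
  rw [hC.mem_V] at hn hv
  obtain ⟨c, hc, h⟩ := hC.exists_eq_D
    (C.prod_mem_weight (m := 2) 0 hv.1 hn.1 (by norm_num)) (C.mem_annih_succ.1 hn1 v hv.1)
  refine ⟨c, hc, h, ?_⟩
  have h2 := C.L_two_prod hv.1 0 n
  rw [h, hn.2, hv.2, C.L_two_D, hC.L_two_one hc, C.mem_weight.1 hc] at h2
  simp only [map_zero, LinearMap.zero_apply, add_zero, zero_add, one_smul] at h2
  rw [h2]; norm_num

/-- Up to total derivatives, exchanging the last two arguments of `v_(0) (w_(0) (u_(1) n))`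
multiplies it by `-1/2`, for `n` in the radical; hence it vanishes. -/
theorem IsPhysical.prod_one_radical_exchange (hC : C.IsPhysical) {n v w u : R} (hn : n ∈ C.V)
    (hn1 : n ∈ C.annih 1) (hv : v ∈ C.V) (hw : w ∈ C.V) (hu : u ∈ C.V) :
    (2 : ℂ) • C.prod 0 v (C.prod 0 w (C.prod 1 u n)) + C.prod 0 v (C.prod 0 u (C.prod 1 w n))
      ∈ C.der := by
  obtain ⟨c, hc, h, h2⟩ := hC.exists_prod_zero_eq_D hn hn1 hw
  have hu' := (hC.mem_V.1 hu).1
  have hv' := (hC.mem_V.1 hv).1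
  have hw' := (hC.mem_V.1 hw).1
  have e := C.prod_D_succ 0 u c
  rw [C.odd_zero_odd 1 (hC.threeHalves_mem_parity hw') (hC.threeHalves_mem_parity hu') n, h, e,
    ← h2]
  have h3 : C.prod 0 v (C.prod 1 (C.prod 0 w u) n) ∈ C.der :=
    C.mem_annih_succ.1 (hC.prod_one_prod_mem (hC.prod_zero_mem_annih 1) hw' hu'
      (hC.mem_V.1 hn).1 hn1) v hv'
  have h4 := C.prod_zero_mem_der v (C.D_mem_der (C.prod 1 u c))
  have h5 := Submodule.smul_mem _ (2 : ℂ) (Submodule.sub_mem _ h3 h4)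
  convert h5 using 1
  simp only [map_sub, map_add, map_smul]
  push_cast
  module

theorem IsPhysical.prod_one_radical_mem_annih (hC : C.IsPhysical) {n u : R} (hn : n ∈ C.V)
    (hn1 : n ∈ C.annih 1) (hu : u ∈ C.weight (3 / 2)) : C.prod 1 u n ∈ C.annih 2 := by
  have key : ∀ u ∈ C.V, C.prod 1 u n ∈ C.annih 2 := fun u hu =>
    hC.mem_annih_succ_of_V fun w hw => hC.mem_annih_succ_of_V fun v hv => by
      have h1 := hC.prod_one_radical_exchange hn hn1 hv hw hu
      have h2 := hC.prod_one_radical_exchange hn hn1 hv hu hw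
      have h3 := Submodule.smul_mem _ (1 / 3 : ℂ)
        (Submodule.sub_mem _ (Submodule.smul_mem _ (2 : ℂ) h1) h2)
      change _ ∈ C.der
      convert h3 using 1
      module
  have h1 := key _ (hC.sub_mem_V hu)
  have hE : C.prod 2 C.L u ∈ C.weight (1 / 2) := C.L_two_mem_weight hu (by norm_num)
  have h2 := hC.half_prod_mem_annih hE 1 n hn1
  have e := C.D_prod_succ 0 (C.prod 2 C.L u) n
  rw [map_sub, LinearMap.sub_apply, e] at h1
  convert Submodule.sub_mem _ h1 h2 using 1
  push_cast
  module

theorem IsPhysical.even_prod_one_radical_mem_annih (hC : C.IsPhysical) {n a : R} (hn : n ∈ C.V)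
    (hn1 : n ∈ C.annih 1) (ha : a ∈ C.weight 1) : C.prod 1 a n ∈ C.annih 3 := by
  refine hC.mem_annih_succ_of_V fun v hv => ?_
  have hv' := (hC.mem_V.1 hv).1
  obtain ⟨c, hc, h, h2⟩ := hC.exists_prod_zero_eq_D hn hn1 hv
  have hc2 : c ∈ C.annih 2 := by
    have := hC.prod_one_radical_mem_annih hn hn1 hv'
    rw [← h2] at this
    exact (Submodule.smul_mem_iff _ two_ne_zero).1 this
  have e := C.prod_D_succ 0 a c
  rw [C.zero_even 1 (hC.threeHalves_mem_parity hv') (hC.one_mem_parity ha) n, h, e]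
  exact Submodule.add_mem _
    (hC.prod_one_radical_mem_annih hn hn1 (C.prod_mem_weight 0 hv' ha (by norm_num)))
    (Submodule.add_mem _ (C.der_le_annih 2 (C.D_mem_der _))
      (Submodule.smul_mem _ _ (hC.prod_zero_mem_annih 2 a ha c hc2)))

theorem IsPhysical.prod_one_half_radical_mem_annih (hC : C.IsPhysical) {n w f : R}
    (hn : n ∈ C.V) (hn1 : n ∈ C.annih 1) (hw : w ∈ C.weight (3 / 2))
    (hf : f ∈ C.weight (1 / 2)) : C.prod 1 w (C.prod 0 f n) ∈ C.annih 3 := by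
  have h := C.odd_zero_odd 1 (hC.half_mem_parity hf) (hC.threeHalves_mem_parity hw) n
  have h' : C.prod 1 w (C.prod 0 f n) =
      C.prod 1 (C.prod 0 f w) n - C.prod 0 f (C.prod 1 w n) := by rw [h]; abel
  rw [h']
  exact Submodule.sub_mem _
    (hC.even_prod_one_radical_mem_annih hn hn1 (C.prod_mem_weight 0 hf hw (by norm_num)))
    (hC.half_prod_mem_annih hf 2 _ (hC.prod_one_radical_mem_annih hn hn1 hw))

/-- For `w, u ∈ V` and `n` in the radical, the commutation relations give
`w_(1) (u_(1) n) = n_(1) (w_(1) u)`, which reduces two `1`-st products by `V` to one by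
`w_(1) u`. -/
theorem IsPhysical.prod_one_prod_one_radical (hC : C.IsPhysical) {n w u : R} (hn : n ∈ C.V)
    (hn1 : n ∈ C.annih 1) (hw : w ∈ C.V) (hu : u ∈ C.V) :
    C.prod 1 w (C.prod 1 u n) = C.prod 1 n (C.prod 1 w u) := by
  obtain ⟨c, hc, h, h2⟩ := hC.exists_prod_zero_eq_D hn hn1 hw
  rw [hC.mem_V] at hn hw hu
  have e := C.D_prod_succ 1 c u
  rw [hC.prod_one_swap hu.1 hn.1, map_neg, C.odd_one_odd 1 (hC.threeHalves_mem_parity hw.1)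
    (hC.threeHalves_mem_parity hn.1) u, h, e, ← h2, map_smul, LinearMap.smul_apply]
  push_cast
  module

theorem IsPhysical.prod_one_prod_one_radical_mem_annih (hC : C.IsPhysical) {n w u : R}
    (hn : n ∈ C.V) (hn1 : n ∈ C.annih 1) (hw : w ∈ C.weight (3 / 2))
    (hu : u ∈ C.weight (3 / 2)) : C.prod 1 w (C.prod 1 u n) ∈ C.annih 3 := by
  have hn' := (hC.mem_V.1 hn).1
  have hVV : ∀ w ∈ C.V, ∀ u ∈ C.V, C.prod 1 w (C.prod 1 u n) ∈ C.annih 3 := by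
    intro w hw u hu
    rw [hC.prod_one_prod_one_radical hn hn1 hw hu]
    have hb : C.prod 1 w u ∈ C.weight 1 :=
      C.prod_mem_weight 1 (hC.mem_V.1 hw).1 (hC.mem_V.1 hu).1 (by norm_num)
    obtain ⟨y, hy⟩ := C.prod_eq_swap_add_der 1 (hC.threeHalves_mem_parity hn')
      (hC.one_mem_parity hb)
    rw [hy]
    exact Submodule.add_mem _
      (Submodule.smul_mem _ _ (hC.even_prod_one_radical_mem_annih hn hn1 hb))
      (C.der_le_annih 3 (C.D_mem_der y))
  have hQV : ∀ w ∈ C.weight (3 / 2), ∀ u ∈ C.V, C.prod 1 w (C.prod 1 u n) ∈ C.annih 3 := by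
    intro w hw u hu
    have hE : C.prod 2 C.L w ∈ C.weight (1 / 2) := C.L_two_mem_weight hw (by norm_num)
    have h1 := hVV _ (hC.sub_mem_V hw) u hu
    have h2 := hC.half_prod_mem_annih hE 2 _
      (hC.prod_one_radical_mem_annih hn hn1 (hC.mem_V.1 hu).1)
    have e := C.D_prod_succ 0 (C.prod 2 C.L w) (C.prod 1 u n)
    rw [map_sub, LinearMap.sub_apply, e] at h1
    convert Submodule.sub_mem _ h1 h2 using 1
    push_cast
    module
  have hE : C.prod 2 C.L u ∈ C.weight (1 / 2) := C.L_two_mem_weight hu (by norm_num)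
  have h1 := hQV w hw _ (hC.sub_mem_V hu)
  have h2 := hC.prod_one_half_radical_mem_annih hn hn1 hw hE
  have e := C.D_prod_succ 0 (C.prod 2 C.L u) n
  rw [map_sub, LinearMap.sub_apply, e, map_sub, map_smul] at h1
  convert Submodule.sub_mem _ h1 h2 using 1
  push_cast
  module

variable (C)

/-! ### The largest proper ideal -/

/-- Weight `1/2` part of the largest proper ideal: the space `F³`. -/
noncomputable def radF : Submodule ℂ R := C.weight (1 / 2) ⊓ C.annih 3

/-- Weight `1` part of the largest proper ideal. -/
noncomputable def radA : Submodule ℂ R :=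
  C.weight 1 ⊓ C.annih 2 ⊓ ⨅ u : C.weight (3 / 2), (C.annih 3).comap (C.prod 1 u.1)

/-- Reduced weight `3/2` part of the largest proper ideal: the radical of the inner product. -/
noncomputable def radV : Submodule ℂ R := C.V ⊓ C.annih 1

/-- The `ℂ[∂]`-submodule generated by the three pieces above. It is an ideal, and it does not
contain `L` unless `L = 0`. -/
noncomputable def rad : Submodule ℂ R := C.DSpan (C.radF ⊔ C.radA ⊔ C.radV)

theorem mem_radA {a : R} : a ∈ C.radA ↔ a ∈ C.weight 1 ∧ a ∈ C.annih 2 ∧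
    ∀ u ∈ C.weight (3 / 2), C.prod 1 u a ∈ C.annih 3 := by
  simp [radA, and_assoc]

theorem radF_le_rad : C.radF ≤ C.rad :=
  (le_sup_of_le_left le_sup_left).trans (C.le_DSpan _)

theorem radA_le_rad : C.radA ≤ C.rad :=
  (le_sup_of_le_left le_sup_right).trans (C.le_DSpan _)

theorem radV_le_rad : C.radV ≤ C.rad := le_sup_right.trans (C.le_DSpan _)

variable {C}

theorem IsPhysical.prod_one_mem_radA (hC : C.IsPhysical) {n u : R} (hn : n ∈ C.radV)
    (hu : u ∈ C.weight (3 / 2)) : C.prod 1 u n ∈ C.radA :=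
  C.mem_radA.2 ⟨C.prod_mem_weight 1 hu (hC.mem_V.1 hn.1).1 (by norm_num),
    hC.prod_one_radical_mem_annih hn.1 hn.2 hu,
    fun _ hw => hC.prod_one_prod_one_radical_mem_annih hn.1 hn.2 hw hu⟩

theorem IsPhysical.prod_zero_mem_radA_of_half (hC : C.IsPhysical) {f u : R} (hf : f ∈ C.radF)
    (hu : u ∈ C.weight (3 / 2)) : C.prod 0 u f ∈ C.radA := by
  refine C.mem_radA.2 ⟨C.prod_mem_weight 0 hu hf.1 (by norm_num),
    C.mem_annih_succ.1 hf.2 u hu, fun w hw => ?_⟩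
  have h0 : C.prod 1 w f = 0 := hC.prod_eq_zero hw hf.1 1 0 le_rfl (by norm_num)
  rw [C.odd_one_odd 0 (hC.threeHalves_mem_parity hw) (hC.threeHalves_mem_parity hu) f, h0,
    map_zero, sub_zero]
  exact Submodule.add_mem _
    (hC.prod_one_prod_mem (hC.prod_zero_mem_annih 3) hw hu hf.1 hf.2)
    (hC.prod_zero_mem_annih 3 _ (C.prod_mem_weight 1 hw hu (by norm_num)) f hf.2)

theorem IsPhysical.even_prod_zero_mem_radA (hC : C.IsPhysical) {a b : R} (ha : a ∈ C.radA)
    (hb : b ∈ C.weight 1) : C.prod 0 b a ∈ C.radA := by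
  obtain ⟨ha1, ha2, ha3⟩ := C.mem_radA.1 ha
  refine C.mem_radA.2 ⟨C.prod_mem_weight 0 hb ha1 (by norm_num),
    hC.prod_zero_mem_annih 2 b hb a ha2, fun u hu => ?_⟩
  have h := C.even_zero 1 (hC.one_mem_parity hb) (hC.threeHalves_mem_parity hu) a
  have h' : C.prod 1 u (C.prod 0 b a) =
      C.prod 0 b (C.prod 1 u a) - C.prod 1 (C.prod 0 b u) a := by rw [h]; abel
  rw [h']
  exact Submodule.sub_mem _ (hC.prod_zero_mem_annih 3 b hb _ (ha3 u hu))
    (ha3 _ (C.prod_mem_weight 0 hb hu (by norm_num)))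

/-- A vector of weight `3/2` in the first annihilator lies in `rad` once its component along
`∂F` does. -/
theorem IsPhysical.mem_rad_of_threeHalves (hC : C.IsPhysical) {x : R}
    (hx : x ∈ C.weight (3 / 2)) (h1 : x ∈ C.annih 1) (hE : C.prod 2 C.L x ∈ C.annih 3) :
    x ∈ C.rad := by
  have hw : C.prod 2 C.L x ∈ C.weight (1 / 2) := C.L_two_mem_weight hx (by norm_num)
  have h2 : C.prod 2 C.L x ∈ C.rad := C.radF_le_rad ⟨hw, hE⟩
  have h3 : x - C.D (C.prod 2 C.L x) ∈ C.rad := C.radV_le_rad ⟨hC.sub_mem_V hx,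
    Submodule.sub_mem _ h1 (C.der_le_annih 1 (C.D_mem_der _))⟩
  simpa using Submodule.add_mem _ h3 (C.D_mem_DSpan h2)

theorem IsPhysical.L_prod_mem_rad (hC : C.IsPhysical) {x : R}
    (hx : x ∈ C.radF ∨ x ∈ C.radA ∨ x ∈ C.radV) (n : ℕ) : C.prod n C.L x ∈ C.rad := by
  have hxr : x ∈ C.rad := by
    rcases hx with h | h | h
    exacts [C.radF_le_rad h, C.radA_le_rad h, C.radV_le_rad h]
  obtain ⟨z, hz, hxz, hE⟩ : ∃ z : ℤ, z ≤ 3 ∧ x ∈ C.weight (z / 2) ∧ C.prod 2 C.L x = 0 := by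
    rcases hx with h | h | h
    · exact ⟨1, by norm_num, by simpa using h.1, hC.L_two_half h.1⟩
    · exact ⟨2, by norm_num, by simpa using (C.mem_radA.1 h).1,
        hC.L_two_one (C.mem_radA.1 h).1⟩
    · exact ⟨3, by norm_num, by simpa using (hC.mem_V.1 h.1).1, (hC.mem_V.1 h.1).2⟩
  match n with
  | 0 => rw [C.L_zero]; exact C.D_mem_DSpan hxr
  | 1 => rw [C.mem_weight.1 hxz]; exact Submodule.smul_mem _ _ hxr
  | 2 => rw [hE]; exact zero_mem _
  | n + 3 =>
    rw [hC.prod_eq_zero C.L_mem_weight hxz (n + 3) (z - 2 * n - 4) (by omega)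
      (by push_cast; ring)]
    exact zero_mem _

theorem IsPhysical.V_prod_mem_rad (hC : C.IsPhysical) {x u : R} (hu : u ∈ C.V)
    (hx : x ∈ C.radF ∨ x ∈ C.radA ∨ x ∈ C.radV) (n : ℕ) : C.prod n u x ∈ C.rad := by
  obtain ⟨hu', huE⟩ := hC.mem_V.1 hu
  rcases hx with h | h | h
  · match n with
    | 0 => exact C.radA_le_rad (hC.prod_zero_mem_radA_of_half h hu')
    | n + 1 =>
      rw [hC.prod_eq_zero hu' h.1 (n + 1) (-2 * n) (by omega) (by push_cast; ring)]
      exact zero_mem _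
  · obtain ⟨h1, h2, h3⟩ := C.mem_radA.1 h
    match n with
    | 0 =>
      refine hC.mem_rad_of_threeHalves (C.prod_mem_weight 0 hu' h1 (by norm_num))
        (C.mem_annih_succ.1 h2 u hu') ?_
      rw [C.L_two_prod hu', huE, hC.L_two_one h1]
      simpa using Submodule.smul_mem _ _ (h3 u hu')
    | 1 => exact C.radF_le_rad ⟨C.prod_mem_weight 1 hu' h1 (by norm_num), h3 u hu'⟩
    | n + 2 =>
      rw [hC.prod_eq_zero hu' h1 (n + 2) (-2 * n - 1) (by omega) (by push_cast; ring)]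
      exact zero_mem _
  · have hA := hC.prod_one_mem_radA h hu'
    match n with
    | 0 =>
      obtain ⟨c, hc, hD, h2⟩ := hC.exists_prod_zero_eq_D h.1 h.2 hu
      rw [← h2] at hA
      rw [hD]
      exact C.D_mem_DSpan (C.radA_le_rad ((Submodule.smul_mem_iff _ two_ne_zero).1 hA))
    | 1 => exact C.radA_le_rad hA
    | n + 2 =>
      rw [hC.prod_eq_zero hu' (hC.mem_V.1 h.1).1 (n + 2) (-2 * n) (by omega)
        (by push_cast; ring)]
      exact zero_mem _

theorem IsPhysical.one_prod_mem_rad (hC : C.IsPhysical) {x a : R} (ha : a ∈ C.weight 1)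
    (hx : x ∈ C.radF ∨ x ∈ C.radA ∨ x ∈ C.radV) (n : ℕ) : C.prod n a x ∈ C.rad := by
  rcases hx with h | h | h
  · match n with
    | 0 => exact C.radF_le_rad ⟨C.prod_mem_weight 0 ha h.1 (by norm_num),
        hC.prod_zero_mem_annih 3 a ha x h.2⟩
    | n + 1 =>
      rw [hC.prod_eq_zero ha h.1 (n + 1) (-2 * n - 1) (by omega) (by push_cast; ring)]
      exact zero_mem _
  · match n with
    | 0 => exact C.radA_le_rad (hC.even_prod_zero_mem_radA h ha)
    | n + 1 =>
      rw [hC.prod_eq_zero ha (C.mem_radA.1 h).1 (n + 1) (-2 * n) (by omega)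
        (by push_cast; ring)]
      exact zero_mem _
  · obtain ⟨h1, hE⟩ := hC.mem_V.1 h.1
    match n with
    | 0 =>
      refine hC.mem_rad_of_threeHalves (C.prod_mem_weight 0 ha h1 (by norm_num))
        (hC.prod_zero_mem_annih 1 a ha x h.2) ?_
      rw [C.L_two_prod ha, hC.L_two_one ha, hE]
      simp
    | 1 => exact C.radF_le_rad ⟨C.prod_mem_weight 1 ha h1 (by norm_num),
        hC.even_prod_one_radical_mem_annih h.1 h.2 ha⟩
    | n + 2 =>
      rw [hC.prod_eq_zero ha h1 (n + 2) (-2 * n - 1) (by omega) (by push_cast; ring)]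
      exact zero_mem _

theorem IsPhysical.half_prod_mem_rad (hC : C.IsPhysical) {x f : R} (hf : f ∈ C.weight (1 / 2))
    (hx : x ∈ C.radF ∨ x ∈ C.radA ∨ x ∈ C.radV) (n : ℕ) : C.prod n f x ∈ C.rad := by
  rcases hx with h | h | h
  · rw [hC.prod_eq_zero hf h.1 n (-2 * n) (by omega) (by push_cast; ring)]
    exact zero_mem _
  · obtain ⟨h1, h2, -⟩ := C.mem_radA.1 h
    match n with
    | 0 => exact C.radF_le_rad ⟨C.prod_mem_weight 0 hf h1 (by norm_num),
        hC.half_prod_mem_annih hf 2 x h2⟩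
    | n + 1 =>
      rw [hC.prod_eq_zero hf h1 (n + 1) (-2 * n - 1) (by omega) (by push_cast; ring)]
      exact zero_mem _
  · have h1 := (hC.mem_V.1 h.1).1
    match n with
    | 0 => exact C.radA_le_rad (C.mem_radA.2 ⟨C.prod_mem_weight 0 hf h1 (by norm_num),
        hC.half_prod_mem_annih hf 1 x h.2,
        fun w hw => hC.prod_one_half_radical_mem_annih h.1 h.2 hw hf⟩)
    | n + 1 =>
      rw [hC.prod_eq_zero hf h1 (n + 1) (-2 * n) (by omega) (by push_cast; ring)]
      exact zero_mem _

theorem IsPhysical.isIdeal_rad (hC : C.IsPhysical) : C.IsIdeal C.rad := by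
  refine ⟨fun x hx => C.D_mem_DSpan hx, ?_⟩
  -- For a fixed left factor it suffices to multiply the generators of `rad`.
  have right : ∀ g : R,
      (∀ x, (x ∈ C.radF ∨ x ∈ C.radA ∨ x ∈ C.radV) → ∀ n, C.prod n g x ∈ C.rad) →
      ∀ n, ∀ x ∈ C.rad, C.prod n g x ∈ C.rad := by
    intro g hg
    have hle : C.rad ≤ ⨅ n : ℕ, C.rad.comap (C.prod n g) := by
      refine C.DSpan_le (sup_le (sup_le ?_ ?_) ?_) ?_
      · exact fun x hx => by simpa using hg x (Or.inl hx)
      · exact fun x hx => by simpa using hg x (Or.inr (Or.inl hx))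
      · exact fun x hx => by simpa using hg x (Or.inr (Or.inr hx))
      · intro x hx
        simp only [Submodule.mem_iInf, Submodule.mem_comap] at hx ⊢
        intro n
        cases n with
        | zero => rw [C.prod_D_zero]; exact C.D_mem_DSpan (hx 0)
        | succ n =>
          rw [C.prod_D_succ]
          exact Submodule.add_mem _ (C.D_mem_DSpan (hx _)) (Submodule.smul_mem _ _ (hx n))
    intro n x hx
    have := hle hx
    simp only [Submodule.mem_iInf, Submodule.mem_comap] at this
    exact this n
  have left : (⨅ n : ℕ, ⨅ x : C.rad, C.rad.comap ((C.prod n).flip x.1)) = ⊤ := by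
    refine hC.eq_top_of_generators ?_ ?_ ?_ ?_ ?_
    · intro a ha
      simp only [Submodule.mem_iInf, Submodule.mem_comap, LinearMap.flip_apply] at ha ⊢
      intro n x
      rw [C.D_prod]
      exact Submodule.smul_mem _ _ (ha _ x)
    · simp only [Submodule.mem_iInf, Submodule.mem_comap, LinearMap.flip_apply]
      exact fun n x => right _ (fun _ => hC.L_prod_mem_rad) n x.1 x.2
    all_goals
      intro a ha
      simp only [Submodule.mem_iInf, Submodule.mem_comap, LinearMap.flip_apply]
    · exact fun n x => right _ (fun _ => hC.V_prod_mem_rad ha) n x.1 x.2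
    · exact fun n x => right _ (fun _ => hC.one_prod_mem_rad ha) n x.1 x.2
    · exact fun n x => right _ (fun _ => hC.half_prod_mem_rad ha) n x.1 x.2
  intro n a x hx
  have ha : a ∈ (⨅ n : ℕ, ⨅ x : C.rad, C.rad.comap ((C.prod n).flip x.1)) := by
    rw [left]; trivial
  simp only [Submodule.mem_iInf, Submodule.mem_comap, LinearMap.flip_apply] at ha
  exact ha n ⟨x, hx⟩

theorem IsPhysical.L_notMem_rad (hC : C.IsPhysical) (hL : C.L ≠ 0) : C.L ∉ C.rad := by
  have hle : C.rad ≤ C.der.comap (C.weightProj 2) := by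
    have h0 : ∀ k : ℂ, k ≠ 2 → C.weight k ≤ C.der.comap (C.weightProj 2) := by
      intro k hk x hx
      rw [Submodule.mem_comap, C.weightProj_eq_zero hx hk]
      exact zero_mem _
    refine C.DSpan_le (sup_le (sup_le ?_ ?_) ?_) ?_
    · exact inf_le_left.trans (h0 _ (by norm_num))
    · exact fun x hx => h0 1 (by norm_num) (C.mem_radA.1 hx).1
    · exact fun x hx => h0 (3 / 2) (by norm_num) (hC.mem_V.1 hx.1).1
    · intro x _
      rw [Submodule.mem_comap, C.weightProj_D (k := 1) (by norm_num)]
      exact C.D_mem_der _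
  intro h
  have h2 := hle h
  rw [Submodule.mem_comap, C.weightProj_self C.L_mem_weight] at h2
  exact hL (hC.eq_zero_of_mem_der C.L_two_L h2)

/-! ### The inner product -/

theorem IsPhysical.eq_zero_of_L_eq_zero (hC : C.IsPhysical) (hL : C.L = 0) (x : R) : x = 0 :=
  hC.eq_zero_of_mem_weight_zero (C.mem_weight.2 (by simp [hL]))

theorem IsPhysical.L_notMem_der (hC : C.IsPhysical) (hL : C.L ≠ 0) : C.L ∉ C.der :=
  fun h => hL (hC.eq_zero_of_mem_der C.L_two_L h)

theorem IsPhysical.exists_isInnerProduct (hC : C.IsPhysical) :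
    ∃ B : LinearMap.BilinForm ℂ C.V, C.IsInnerProduct B := by
  by_cases hL : C.L = 0
  · exact ⟨0, fun u v => by
      rw [hC.eq_zero_of_L_eq_zero hL (C.redProd 0 u v), hL, smul_zero]⟩
  -- A linear functional that vanishes on `∂R` and takes the value `1` at `L`.
  obtain ⟨g, hgL, hg⟩ := Submodule.exists_le_ker_of_notMem (hC.L_notMem_der hL)
  let φ : R →ₗ[ℂ] ℂ := (g C.L)⁻¹ • g
  have hφL : φ C.L = 1 := inv_mul_cancel₀ hgL
  have hφ : ∀ x, φ (C.D x) = 0 := fun x => by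
    have : g (C.D x) = 0 := hg (C.D_mem_der x)
    simp [φ, this]
  refine ⟨((C.prod 0).compr₂ φ).compl₁₂ C.V.subtype C.V.subtype, fun u v => ?_⟩
  obtain ⟨c, b, hb, h⟩ := hC.exists_eq_of_mem_weight_two
    (C.prod_mem_weight (m := 2) 0 (hC.mem_V.1 u.2).1 (hC.mem_V.1 v.2).1 (by norm_num))
  have hB : ((C.prod 0).compr₂ φ).compl₁₂ C.V.subtype C.V.subtype u v = c := by
    change φ (C.prod 0 u v) = c
    rw [h, map_add, map_smul, hφ, hφL]; simp
  rw [hB]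
  refine hC.zeroPart_eq (by rw [map_smul, C.L_two_L, smul_zero]) ?_
  rw [h, add_sub_cancel_left]
  exact C.D_mem_der b

theorem IsPhysical.isInnerProduct_unique (hC : C.IsPhysical) {B B' : LinearMap.BilinForm ℂ C.V}
    (hB : C.IsInnerProduct B) (hB' : C.IsInnerProduct B') : B = B' := by
  refine LinearMap.ext fun u => LinearMap.ext fun v => ?_
  by_cases hL : C.L = 0
  · have hu : u = 0 := Subtype.ext (hC.eq_zero_of_L_eq_zero hL u)
    rw [hu]; simp
  · exact smul_left_injective ℂ hL ((hB u v).symm.trans (hB' u v))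

theorem IsPhysical.inner_eq_zero_iff (hC : C.IsPhysical) {B : LinearMap.BilinForm ℂ C.V}
    (hB : C.IsInnerProduct B) (hL : C.L ≠ 0) (u v : C.V) :
    B u v = 0 ↔ C.prod 0 (u : R) (v : R) ∈ C.der := by
  rw [← hC.redProd_eq_zero_iff, hB u v, smul_eq_zero, or_iff_left hL]

/-- The inner product is nondegenerate exactly when no nonzero vector of `V` is orthogonal to
`V`; by symmetry the left and the right radical agree. -/
theorem IsPhysical.nondegenerate_iff (hC : C.IsPhysical) {B : LinearMap.BilinForm ℂ C.V}
    (hB : C.IsInnerProduct B) : B.Nondegenerate ↔ C.radV = ⊥ := by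
  by_cases hL : C.L = 0
  · have hz := hC.eq_zero_of_L_eq_zero hL
    exact iff_of_true ⟨fun u _ => Subtype.ext (hz u), fun u _ => Subtype.ext (hz u)⟩
      ((Submodule.eq_bot_iff _).2 fun x _ => hz x)
  have hsymm : ∀ u v : C.V, B u v = 0 → B v u = 0 := by
    intro u v h
    rw [hC.inner_eq_zero_iff hB hL] at *
    have h2 := hC.prod_zero_swap (hC.mem_V.1 v.2).1 (hC.mem_V.1 u.2).1
    simpa using Submodule.add_mem _ h2 h
  have hrad : ∀ n : C.V, (n : R) ∈ C.radV ↔ ∀ u : C.V, B u n = 0 := by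
    intro n
    simp only [hC.inner_eq_zero_iff hB hL]
    exact ⟨fun h u => C.mem_annih_succ.1 h.2 u (hC.mem_V.1 u.2).1,
      fun h => ⟨n.2, hC.mem_annih_succ_of_V fun u hu => h ⟨u, hu⟩⟩⟩
  constructor
  · intro h
    refine (Submodule.eq_bot_iff _).2 fun n hn => ?_
    have := h.2 ⟨n, hn.1⟩ ((hrad ⟨n, hn.1⟩).1 hn)
    simpa using this
  · intro h
    have h0 : ∀ n : C.V, (∀ u, B u n = 0) → n = 0 := fun n hn => by
      have := (hrad n).2 hn
      rw [h] at this
      exact Subtype.ext this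
    exact ⟨fun n hn => h0 n fun u => hsymm _ _ (hn u), h0⟩

theorem IsPhysical.mem_FCubed_iff (hC : C.IsPhysical) {f : R} : f ∈ C.FCubed ↔ f ∈ C.radF := by
  rw [hC.mem_FCubed]
  exact and_congr_right fun _ =>
    ⟨fun h => hC.mem_annih_succ_of_V fun w hw => hC.mem_annih_succ_of_V fun v hv =>
      hC.mem_annih_succ_of_V fun u hu => h u hu v hv w hw,
    fun h u hu v hv w hw => C.mem_annih_succ.1 (C.mem_annih_succ.1 (C.mem_annih_succ.1 h w
      (hC.mem_V.1 hw).1) v (hC.mem_V.1 hv).1) u (hC.mem_V.1 hu).1⟩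

/-! ### Simplicity -/

theorem IsPhysical.rad_eq_bot (hC : C.IsPhysical) (hs : C.IsSimple) : C.rad = ⊥ := by
  by_cases hL : C.L = 0
  · exact (Submodule.eq_bot_iff _).2 fun x _ => hC.eq_zero_of_L_eq_zero hL x
  · refine (hs _ hC.isIdeal_rad).resolve_right fun h => hC.L_notMem_rad hL ?_
    rw [h]; trivial

theorem IsPhysical.eq_top_of_L_mem (hC : C.IsPhysical) {I : Submodule ℂ R} (hI : C.IsIdeal I)
    (hL : C.L ∈ I) : I = ⊤ := by
  refine eq_top_iff.2 fun x _ => ?_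
  refine C.weight_induction (p := fun x => x ∈ I) ?_ (fun x y => I.add_mem) x
  intro k x hx
  by_cases hk : k = 0
  · subst hk
    rw [hC.eq_zero_of_mem_weight_zero hx]; exact I.zero_mem
  · have h := hI.L_one_mem hL x
    rw [C.mem_weight.1 hx] at h
    exact (I.smul_mem_iff hk).1 h

theorem IsPhysical.mem_der_of_mem_ideal (hC : C.IsPhysical) {I : Submodule ℂ R}
    (hI : C.IsIdeal I) (hL : C.L ∉ I) {y : R} (hy : y ∈ C.weight 2) (hyI : y ∈ I) :
    y ∈ C.der := by
  obtain ⟨c, b, hb, rfl⟩ := hC.exists_eq_of_mem_weight_two hy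
  by_cases hc : c = 0
  · rw [hc, zero_smul, zero_add]; exact C.D_mem_der b
  · exfalso
    -- `L_(2)` recovers `b` from `c L + ∂ b`, so `c L` lies in the ideal as well.
    have h2 := hI.2 2 C.L _ hyI
    rw [map_add, map_smul, C.L_two_L, C.L_two_D, hC.L_two_one hb, C.mem_weight.1 hb, map_zero,
      smul_zero, zero_add, zero_add, one_smul] at h2
    have hbI := (I.smul_mem_iff two_ne_zero).1 h2
    have h3 := I.sub_mem hyI (hI.1 b hbI)
    rw [add_sub_cancel_right] at h3
    exact hL ((I.smul_mem_iff hc).1 h3)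

/-- If `u_(0) v` is not a total derivative for some `u, v ∈ V`, then no nonzero vector of weight
`1` is annihilated by all products with `V`: the commutator `(u_(0) v)_(1)` acts on it by the
scalar `(u, v)`. -/
theorem IsPhysical.eq_zero_of_prod_V_eq_zero (hC : C.IsPhysical) {u v : R} (hu : u ∈ C.V)
    (hv : v ∈ C.V) (huv : C.prod 0 u v ∉ C.der) {a : R} (ha : a ∈ C.weight 1)
    (h0 : ∀ w ∈ C.V, C.prod 0 w a = 0) (h1 : ∀ w ∈ C.V, C.prod 1 w a = 0) : a = 0 := by
  obtain ⟨hu', huE⟩ := hC.mem_V.1 hu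
  obtain ⟨hv', hvE⟩ := hC.mem_V.1 hv
  obtain ⟨c, b, hb, h⟩ := hC.exists_eq_of_mem_weight_two
    (C.prod_mem_weight (m := 2) 0 hu' hv' (by norm_num))
  have hpu := hC.threeHalves_mem_parity hu'
  have hpv := hC.threeHalves_mem_parity hv'
  have e1 := C.odd_zero_odd 1 hpu hpv a
  have e2 := C.odd_one_odd 0 hpu hpv a
  rw [h1 v hv, h0 u hu, map_zero, map_zero, sub_zero] at e1
  rw [h0 v hv, h1 u hu, map_zero, map_zero, sub_zero, zero_add, ← e1, zero_add] at e2
  have hb2 : (2 : ℂ) • b = C.prod 1 u v := by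
    have h2 := C.L_two_prod hu' 0 v
    rw [h, huE, hvE, map_add, map_smul, C.L_two_L, C.L_two_D, hC.L_two_one hb,
      C.mem_weight.1 hb] at h2
    simp only [map_zero, LinearMap.zero_apply, add_zero, zero_add, one_smul, smul_zero] at h2
    rw [h2]; norm_num
  have hba : C.prod 0 b a = 0 := by
    rw [← hb2, map_smul, LinearMap.smul_apply] at e2
    exact (smul_eq_zero.1 e2.symm).resolve_left two_ne_zero
  have e3 := C.D_prod_succ 0 b a
  rw [hba, smul_zero] at e3
  rw [h, map_add, map_smul, LinearMap.add_apply, LinearMap.smul_apply, C.mem_weight.1 ha,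
    one_smul, e3, add_zero] at e1
  refine (smul_eq_zero.1 e1.symm).resolve_left fun hc => huv ?_
  rw [h, hc, zero_smul, zero_add]
  exact C.D_mem_der b

theorem IsPhysical.isSimple_of_rad (hC : C.IsPhysical) (hV : C.V ≠ ⊥) (hradV : C.radV = ⊥)
    (hradF : C.radF = ⊥) : C.IsSimple := by
  intro I hI
  by_cases hL : C.L ∈ I
  · exact Or.inr (hC.eq_top_of_L_mem hI hL)
  refine Or.inl ?_
  have hder : ∀ {y}, y ∈ C.weight 2 → y ∈ I → y ∈ C.der := hC.mem_der_of_mem_ideal hI hL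
  obtain ⟨u, v, hu, hv, huv⟩ : ∃ u v, u ∈ C.V ∧ v ∈ C.V ∧ C.prod 0 u v ∉ C.der := by
    by_contra! hcon
    refine hV ((Submodule.eq_bot_iff _).2 fun v hv => ?_)
    have : v ∈ C.radV := ⟨hv, hC.mem_annih_succ_of_V fun u hu => hcon u v hu hv⟩
    rw [hradV] at this
    exact this
  have hIF : ∀ x ∈ I, x ∈ C.weight (1 / 2) → x = 0 := by
    intro x hxI hx
    have : x ∈ C.radF := by
      refine ⟨hx, C.mem_annih_succ.2 fun w hw => C.mem_annih_succ.2 fun v hv =>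
        C.mem_annih_succ.2 fun u hu => ?_⟩
      exact hder (C.prod_mem_weight 0 hu (C.prod_mem_weight (m := 3 / 2) 0 hv
        (C.prod_mem_weight (m := 1) 0 hw hx (by norm_num)) (by norm_num)) (by norm_num))
        (hI.2 _ _ _ (hI.2 _ _ _ (hI.2 _ _ _ hxI)))
    rw [hradF] at this
    exact this
  have hIV : ∀ x ∈ I, x ∈ C.weight (3 / 2) → x = 0 := by
    intro x hxI hx
    have hE : C.prod 2 C.L x = 0 :=
      hIF _ (hI.2 _ _ _ hxI) (C.L_two_mem_weight hx (by norm_num))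
    have : x ∈ C.radV := ⟨hC.mem_V.2 ⟨hx, hE⟩, C.mem_annih_succ.2 fun u hu =>
      hder (C.prod_mem_weight 0 hu hx (by norm_num)) (hI.2 _ _ _ hxI)⟩
    rw [hradV] at this
    exact this
  have hIA : ∀ x ∈ I, x ∈ C.weight 1 → x = 0 := by
    intro x hxI hx
    refine hC.eq_zero_of_prod_V_eq_zero hu hv huv hx (fun w hw => ?_) (fun w hw => ?_)
    · exact hIV _ (hI.2 _ _ _ hxI) (C.prod_mem_weight 0 (hC.mem_V.1 hw).1 hx (by norm_num))
    · exact hIF _ (hI.2 _ _ _ hxI) (C.prod_mem_weight 1 (hC.mem_V.1 hw).1 hx (by norm_num))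
  -- In higher weights `L_(2)` reduces to the previous weights, since all vectors of weight
  -- greater than `2` are total derivatives.
  have hall : ∀ n : ℕ, ∀ x ∈ I, x ∈ C.weight ((n : ℂ) / 2) → x = 0 := by
    intro n
    induction n using Nat.strong_induction_on with
    | _ n ih =>
      intro x hxI hx
      match n with
      | 0 => exact hC.eq_zero_of_mem_weight_zero (by simpa using hx)
      | 1 => exact hIF x hxI (by simpa using hx)
      | 2 => exact hIA x hxI (by simpa using hx)
      | 3 => exact hIV x hxI (by simpa using hx)
      | n + 4 =>
        have hE : C.prod 2 C.L x = 0 := by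
          refine ih (n + 2) (by omega) _ (hI.2 _ _ _ hxI) ?_
          exact C.L_two_mem_weight hx (by push_cast; ring)
        refine hC.eq_zero_of_mem_der hE ?_
        rcases Nat.eq_zero_or_pos n with rfl | hn
        · exact hder (by convert hx using 2; norm_num) hxI
        · exact hC.mem_der_of_weight (n := n + 4) (by omega) hx
  refine C.eq_bot_of_weight (hI.2 1 C.L) fun k x hxI hx => ?_
  by_contra h0
  obtain ⟨n, -, rfl⟩ := hC.weight_cases hx h0
  exact h0 (hall n x hxI hx)

end ConformalSuperalgebra

theorem mainTheorem8 {R : Type*} [AddCommGroup R] [Module ℂ R] (C : ConformalSuperalgebra R)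
    (hC : C.IsPhysical) :
    (∃! B : LinearMap.BilinForm ℂ C.V, C.IsInnerProduct B) ∧
    ∀ B : LinearMap.BilinForm ℂ C.V, C.IsInnerProduct B →
      (C.IsSimple → B.Nondegenerate) ∧
      (C.V ≠ ⊥ → (C.IsSimple ↔ B.Nondegenerate ∧ C.FCubed = {0})) := by
  have hF : C.FCubed = {0} ↔ C.radF = ⊥ := by
    rw [Submodule.eq_bot_iff, Set.eq_singleton_iff_unique_mem]
    simp only [hC.mem_FCubed_iff]
    exact ⟨fun h => h.2, fun h => ⟨zero_mem _, h⟩⟩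
  refine ⟨?_, fun B hB => ⟨fun hs => ?_, fun hV => ⟨fun hs => ⟨?_, ?_⟩, fun h => ?_⟩⟩⟩
  · obtain ⟨B, hB⟩ := hC.exists_isInnerProduct
    exact ⟨B, hB, fun B' hB' => hC.isInnerProduct_unique hB' hB⟩
  · exact (hC.nondegenerate_iff hB).2 (eq_bot_mono C.radV_le_rad (hC.rad_eq_bot hs))
  · exact (hC.nondegenerate_iff hB).2 (eq_bot_mono C.radV_le_rad (hC.rad_eq_bot hs))
  · exact hF.2 (eq_bot_mono C.radF_le_rad (hC.rad_eq_bot hs))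
  · exact hC.isSimple_of_rad hV ((hC.nondegenerate_iff hB).1 h.1) (hF.1 h.2)
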